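/- **Setting.** Let $X=(X(t))_{t\in[0,1]}$ be a jointly measurable real stochastic process with $\mathbb E[X(t)^2]<\infty$ for all $t$, whose paths are square integrable and, as elements of $\mathcal L_2([0,1])$, belong to a set $\mathcal X\subset \mathcal L_2([0,1])$. Let $Y$ be a random label in $\{-1,+1\}$ with $0<\mathbb P\{Y=+1\}<1$, and let $\eta:\mathcal X\to[0,1]$ be a version of the regression function, $\eta(X)=\mathbb P\{Y=+1\mid X\}$ almost surely. Put $C_X(t,s)=\mathbb E[X(t)X(s)]$. For a real random variable $S$ (a score, such as $s(X)$), let $\mathrm{ROC}_S$ be the curve $t\mapsto(\mathbb P\{S>t\mid Y=-1\},\mathbb P\{S>t\mid Y=+1\})$ with jumps joined by line segments, seen as the graph of a function on $(0,1)$, and let $\mathrm{AUC}(S)=\int_0^1\mathrm{ROC}_S(\alpha)\,d\alpha$. Put $\mathrm{AUC}^*=\mathrm{AUC}(\eta(X))$. For a finite-dimensional random vector $Z$, the optimal AUC based on $Z$ is the supremum of $\mathrm{AUC}(s(Z))$ over all measurable real-valued functions $s$. Let $(\phi,\psi)$ be a pair of compactly supported, square integrable scaling function and wavelet on $[0,1]$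 with $\mathcal M$ vanishing moments. That is: $\phi_{j,k}$ and $\psi_{j,k}$, for $j\ge 0$ and $0\le k<2^j$, are given by $\gamma_{j,k}(t)=2^{j/2}\gamma(2^jt-k)$, where for a fixed finite number of indices $k$ at each of the two ends of $[0,1]$ the function $\gamma$ is replaced by an edge generator (compactly supported and square integrable, dilated in the same way from the corresponding end point); there is a level $J\ge0$ such that, for every $j\ge J$, the functions $\phi_{j,k}$ ($0\le k<2^j$) together with the functions $\psi_{m,k}$ ($m\ge j$, $0\le k<2^m$) form an orthonormal basis of $\mathcal L_2([0,1])$; and $\int_0^1t^l\psi_{j,k}(t)\,dt=0$ for all $j\ge J$, all $0\le k<2^j$ and all $0\le l<\mathcal M$. **Proposition (distortion rates).** Assume that $\eta$ is Lipschitz on $\mathcal X$ for the $\mathcal L_2$ norm. (i) Let $0<r<(\mathcal M-1)/2$, and suppose that $C_X$ is of class $\mathcal C^{2r}$ on the diagonal: there are $c_0<\infty$ and $\delta>0$ such that for every $t_0\in[0,1]$ there is a bivariate polynomial $P$ of degree at most $\lfloor 2r\rfloor$ with $|C_X(t,s)-P(t,s)|\le c_0(|t-t_0|+|s-t_0|)^{2r}$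 for all $t,s\in[0,1]$ with $|t-t_0|\le\delta$ and $|s-t_0|\le\delta$. Then there is a constant $c<\infty$ such that $$\forall j\ge0,\quad \mathrm{AUC}^*-\mathrm{AUC}^*_j\le c\,N_j^{-r},\qquad N_j=2^j,$$ where $\mathrm{AUC}^*_j$ is the optimal AUC based on $(\alpha_{j,k})_{0\le k<2^j}$, $\alpha_{j,k}=\int_0^1X(t)\phi_{j,k}(t)\,dt$. (ii) Let $0<r<\mathcal M$ and $j_0\ge J$. Consider the coefficients of $X$ in the orthonormal basis formed by the $\phi_{j_0,k}$ ($0\le k<2^{j_0}$) and the $\psi_{m,k}$ ($m\ge j_0$, $0\le k<2^m$), denoted by $\beta_i$, where $i$ runs through the index set of this basis. Suppose that $\sum_i(\mathbb E[\beta_i^2])^{p/2}<\infty$ for $p=2/(1+2r)$. Then there is a constant $c<\infty$ such that for every $N\ge1$ and every set $\mathcal I_N$ of $N$ indices whose coefficients have the largest second moments (that is, $\mathbb E[\beta_i^2]\ge\mathbb E[\beta_{i'}^2]$ for all $i\in\mathcal I_N$, $i'\notin\mathcal I_N$), $$\mathrm{AUC}^*-\widetilde{\mathrm{AUC}}{}^*_N\le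 c\,N^{-r},$$ where $\widetilde{\mathrm{AUC}}{}^*_N$ is the optimal AUC based on $(\beta_i)_{i\in\mathcal I_N}$. -/

import Mathlib

open MeasureTheory ProbabilityTheory
open scoped NNReal ENNReal

noncomputable section

/-! ### The space `L²([0,1])` and wavelet bases of the interval -/

/-- The Hilbert space `L²([0,1])` of (classes of) real square integrable functions. -/
abbrev L2I : Type := Lp ℝ 2 (volume : Measure unitInterval)

/-- A function on the line together with finitely many left-edge and right-edge variants, from
which the functions on the unit interval are obtained by dyadic dilation and translation.
Only `left k` with `k < nLeft` and `right k` with `k < nRight` are used. -/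
structure EdgeGenerator where
  interior : ℝ → ℝ
  nLeft : ℕ
  nRight : ℕ
  left : ℕ → ℝ → ℝ
  right : ℕ → ℝ → ℝ

namespace EdgeGenerator

/-- The function `γ_{j,k}`, `0 ≤ k < 2^j`: it is `2^{j/2} γ(2^j x - k)` in the interior, and
`2^{j/2} γ^{left}_k(2^j x)`, `2^{j/2} γ^{right}_{2^j-1-k}(2^j (1-x))` at the two edges. -/
def atScale (G : EdgeGenerator) (j k : ℕ) (x : ℝ) : ℝ :=
  Real.sqrt ((2 : ℝ) ^ j) *
    (if k < G.nLeft then G.left k ((2 : ℝ) ^ j * x)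
     else if 2 ^ j ≤ k + G.nRight then G.right (2 ^ j - 1 - k) ((2 : ℝ) ^ j * (1 - x))
     else G.interior ((2 : ℝ) ^ j * x - k))

/-- All the generating functions are square integrable on the line, with compact support. -/
structure IsCompactlySupportedL2 (G : EdgeGenerator) : Prop where
  interior_memLp : MemLp G.interior 2 (volume : Measure ℝ)
  interior_support : HasCompactSupport G.interior
  left_memLp : ∀ k < G.nLeft, MemLp (G.left k) 2 (volume : Measure ℝ)
  left_support : ∀ k < G.nLeft, HasCompactSupport (G.left k)
  right_memLp : ∀ k < G.nRight, MemLp (G.right k) 2 (volume : Measure ℝ)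
  right_support : ∀ k < G.nRight, HasCompactSupport (G.right k)

end EdgeGenerator

/-- Indices of the wavelet basis with coarsest level `j`: `inl k` stands for the scaling function
`φ_{j,k}`, `inr ⟨m, k⟩` for the wavelet `ψ_{j+m,k}`. -/
abbrev WaveletIndex (j : ℕ) : Type := Fin (2 ^ j) ⊕ (Σ m : ℕ, Fin (2 ^ (j + m)))

/-- The functions `φ_{j,k}` (`0 ≤ k < 2^j`) and `ψ_{m,k}` (`m ≥ j`, `0 ≤ k < 2^m`). -/
def waveletFamily (φ ψ : EdgeGenerator) (j : ℕ) : WaveletIndex j → ℝ → ℝ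
  | Sum.inl k => φ.atScale j k
  | Sum.inr ⟨m, k⟩ => ψ.atScale (j + m) k

/-- The restrictions to `[0,1]` of the functions `g i` form an orthonormal basis of `L²([0,1])`. -/
def IsOrthonormalBasisL2I {ι : Type} (g : ι → ℝ → ℝ) : Prop :=
  ∃ b : HilbertBasis ι ℝ L2I, ∀ i,
    (b i : unitInterval → ℝ) =ᵐ[volume] fun t : unitInterval => g i t

/-- `(φ, ψ)` is a pair of compactly supported scaling function / wavelet on `[0,1]` with `M`
vanishing moments; `J` is the level from which on the dilated functions form bases. -/
structure IsIntervalWavelet (φ ψ : EdgeGenerator) (M J : ℕ) : Prop where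
  scaling_supp : φ.IsCompactlySupportedL2
  wavelet_supp : ψ.IsCompactlySupportedL2
  basis : ∀ j, J ≤ j → IsOrthonormalBasisL2I (waveletFamily φ ψ j)
  vanishing : ∀ j, J ≤ j → ∀ k < 2 ^ j, ∀ m < M,
    ∫ t : unitInterval, (t : ℝ) ^ m * ψ.atScale j k t = 0

/-! ### Smoothness on the diagonal -/

/-- `F : [0,1]² → ℝ` is of class `C^a` on the diagonal: near every diagonal point `(t₀, t₀)`, up to
`c (|t - t₀| + |s - t₀|)^a`, it is a polynomial of degree at most `⌊a⌋`, where the constant and the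
size of the neighbourhood are the same along the diagonal. -/
def IsOfClassOnDiagonal (F : unitInterval → unitInterval → ℝ) (a : ℝ) : Prop :=
  ∃ c δ : ℝ, 0 < δ ∧ ∀ t₀ : unitInterval, ∃ p : MvPolynomial (Fin 2) ℝ,
    p.totalDegree ≤ ⌊a⌋₊ ∧
    ∀ t s : unitInterval, |(t : ℝ) - t₀| ≤ δ → |(s : ℝ) - t₀| ≤ δ →
      |F t s - MvPolynomial.eval ![(t : ℝ), (s : ℝ)] p| ≤
        c * (|(t : ℝ) - t₀| + |(s : ℝ) - t₀|) ^ a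

/-! ### ROC curve and AUC -/

section ROC

variable {Ω : Type*} [MeasurableSpace Ω]

/-- The threshold of the test of level `α`: the smallest `t` with `ν{S > t} ≤ α`. -/
def rocThreshold (ν : Measure Ω) (S : Ω → ℝ) (α : ℝ) : ℝ :=
  sInf {t : ℝ | ν.real {ω | t < S ω} ≤ α}

/-- The ROC curve of the score `S`, for the conditional distributions `ν₀` given `Y = -1` and `ν₁`
given `Y = +1`. It is the graph through the points `(ν₀{S > t}, ν₁{S > t})`, in which the jump
at an atom `t` of `S` under `ν₀` is replaced by the line segment from
`(ν₀{S > t}, ν₁{S > t})` to `(ν₀{S ≥ t}, ν₁{S ≥ t})`. -/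
def rocCurve (ν₀ ν₁ : Measure Ω) (S : Ω → ℝ) (α : ℝ) : ℝ :=
  let t := rocThreshold ν₀ S α
  ν₁.real {ω | t < S ω} +
    (α - ν₀.real {ω | t < S ω}) / ν₀.real {ω | S ω = t} * ν₁.real {ω | S ω = t}

/-- The area under the ROC curve of the score `S` (a random variable such as `s(X)`). -/
def auc (P : Measure Ω) (Y : Ω → ℤ) (S : Ω → ℝ) : ℝ :=
  ∫ α in (0 : ℝ)..1, rocCurve (P[|{ω | Y ω = -1}]) (P[|{ω | Y ω = 1}]) S α

/-- The optimal AUC over all (measurable) scoring functions of the random vector `Z`. -/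
def optimalAUC {ι : Type} (P : Measure Ω) (Y : Ω → ℤ) (Z : Ω → ι → ℝ) : ℝ :=
  ⨆ s : {s : (ι → ℝ) → ℝ // Measurable s}, auc P Y fun ω => s.1 (Z ω)

end ROC

/-! ### The functional bipartite ranking model -/

/-- A random curve `X` on `[0,1]` with finite second moments and square integrable paths, in a path
space `paths ⊆ L²([0,1])`, and a random label `Y = ±1`, both values having positive probability,
with regression function `η : paths → [0,1]`, `η(X) = P(Y = +1 | X)` (only the values of `η` on
`paths` matter). -/
structure RankingModel {Ω : Type*} [MeasurableSpace Ω] (P : Measure Ω) where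
  X : Ω → unitInterval → ℝ
  Y : Ω → ℤ
  paths : Set L2I
  η : L2I → ℝ
  measurable_X : Measurable (Function.uncurry X)
  second_order : ∀ t, MemLp (fun ω => X ω t) 2 P
  memLp_X : ∀ ω, MemLp (X ω) 2 (volume : Measure unitInterval)
  measurable_path : @Measurable Ω L2I _ (borel L2I) fun ω => (memLp_X ω).toLp (X ω)
  mem_paths : ∀ ω, (memLp_X ω).toLp (X ω) ∈ paths
  measurable_Y : Measurable Y
  label : ∀ ω, Y ω = -1 ∨ Y ω = 1
  neg_pos : 0 < P {ω | Y ω = -1}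
  pos_pos : 0 < P {ω | Y ω = 1}
  η_mem : ∀ x ∈ paths, η x ∈ Set.Icc (0 : ℝ) 1
  η_spec : P[Set.indicator {ω | Y ω = 1} (fun _ => (1 : ℝ)) |
      MeasurableSpace.comap (fun ω => (memLp_X ω).toLp (X ω)) (borel L2I)]
    =ᵐ[P] fun ω => η ((memLp_X ω).toLp (X ω))

namespace RankingModel

variable {Ω : Type*} [MeasurableSpace Ω] {P : Measure Ω}

/-- The random curve as a random element of `L²([0,1])`. -/
def path (D : RankingModel P) (ω : Ω) : L2I := (D.memLp_X ω).toLp (D.X ω)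

/-- The autocorrelation function `C_X(t,s) = E[X(t) X(s)]`. -/
def autocorr (D : RankingModel P) (t s : unitInterval) : ℝ := ∫ ω, D.X ω t * D.X ω s ∂P

/-- The random coefficient `∫₀¹ X(t) g(t) dt`. -/
def coeff (D : RankingModel P) (g : ℝ → ℝ) (ω : Ω) : ℝ := ∫ t : unitInterval, D.X ω t * g t

/-- The second moment (possibly `∞`) of the coefficient `∫₀¹ X(t) g(t) dt`. -/
def coeffMoment (D : RankingModel P) (g : ℝ → ℝ) : ℝ≥0∞ := ∫⁻ ω, ‖D.coeff g ω‖ₑ ^ 2 ∂P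

/-- `AUC* = AUC(η)`. -/
def aucStar (D : RankingModel P) : ℝ := auc P D.Y fun ω => D.η (D.path ω)

/-- `AUC*_j`: optimal AUC over scoring functions of `(α_{j,k})_{0 ≤ k < 2^j}`. -/
def aucLinear (D : RankingModel P) (φ : EdgeGenerator) (j : ℕ) : ℝ :=
  optimalAUC P D.Y fun ω (k : Fin (2 ^ j)) => D.coeff (φ.atScale j k) ω

/-- `I` is a set of indices whose coefficients have the largest second moments among all the
coefficients in the wavelet basis with coarsest level `j₀`. -/
def IsLargest (D : RankingModel P) (φ ψ : EdgeGenerator) (j₀ : ℕ)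
    (I : Finset (WaveletIndex j₀)) : Prop :=
  ∀ i ∈ I, ∀ i' ∉ I,
    D.coeffMoment (waveletFamily φ ψ j₀ i') ≤ D.coeffMoment (waveletFamily φ ψ j₀ i)

/-- Optimal AUC over scoring functions of the wavelet coefficients with index in `I`. -/
def aucNonlinear (D : RankingModel P) (φ ψ : EdgeGenerator) (j₀ : ℕ)
    (I : Finset (WaveletIndex j₀)) : ℝ :=
  optimalAUC P D.Y fun ω (i : I) => D.coeff (waveletFamily φ ψ j₀ i) ω

end RankingModel

end

/-! The ROC area equals the probability that a positive instance outranks an independent negative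
one, ties counting one half (`integral_rocCurve`). Conditioning on the curve turns it into
`E[k(S,S')(1-η')η]` over two independent copies, divided by `P(Y=1)P(Y=-1)` (`auc_eq`). Comparing
the scores `η(X)` and `S`, the difference of the two kernels is antisymmetric, so symmetrising
leaves only the factor `(η-η')/2`. A misordered pair has `|η-η'|` at most the sum of the two errors
of `S`. Hence the loss of AUC is at most a constant times `E|η(X)-S|`
(`integral_rankKernel_sub_le`).

Take for `S` the regression function, extended to a Lipschitz function on all of `L²`, evaluated at
the truncated expansion of `X`. By the Lipschitz bound, Jensen and Parseval, the loss is at most a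
constant times the square root of the sum of the second moments of the omitted coefficients
(`exists_aucStar_sub_optimalAUC_le`).

It remains to bound this tail. For (i), `E[β²]` is the double integral of `C_X` against `ψ⊗ψ`.
Vanishing moments remove the local polynomial, and the rest gives `2^{-2rm}·2^{-m}` for each of the
`2^m` wavelets of level `m`; the sum over `m ≥ j` is geometric. For (ii), the tail beyond the
largest moments is Stechkin's inequality (`ENNReal.tsum_compl_le_of_largest`). -/

section ROC

variable {Ω : Type*} [MeasurableSpace Ω]

/-- The ranking kernel: `1` for a correctly ordered pair, `1/2` for a tie. -/
noncomputable def rankKernel (x y : ℝ) : ℝ := if y < x then 1 else if x = y then 1 / 2 else 0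

lemma measurable_rankKernel : Measurable (Function.uncurry rankKernel) := by
  unfold Function.uncurry rankKernel
  exact Measurable.ite (measurableSet_lt measurable_snd measurable_fst) measurable_const
    (Measurable.ite (measurableSet_eq_fun measurable_fst measurable_snd) measurable_const
      measurable_const)

lemma rankKernel_nonneg (x y : ℝ) : 0 ≤ rankKernel x y := by
  unfold rankKernel; split_ifs <;> norm_num

lemma rankKernel_le_one (x y : ℝ) : rankKernel x y ≤ 1 := by
  unfold rankKernel; split_ifs <;> norm_num

lemma rankKernel_add_swap (x y : ℝ) : rankKernel x y + rankKernel y x = 1 := by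
  unfold rankKernel
  rcases lt_trichotomy x y with h | h | h
  · simp [h, h.not_gt, h.ne]
  · subst h; norm_num
  · simp [h, h.not_gt, h.ne]

lemma abs_rankKernel_le_one (x y : ℝ) : |rankKernel x y| ≤ 1 :=
  abs_le.2 ⟨by linarith [rankKernel_nonneg x y], rankKernel_le_one x y⟩

/-! ### Survival function and threshold of the test of level `α` -/

variable (ν₀ ν₁ : Measure Ω) [IsProbabilityMeasure ν₀] [IsProbabilityMeasure ν₁] {S : Ω → ℝ}

lemma antitone_measureReal_lt : Antitone fun t : ℝ => ν₀.real {ω | t < S ω} := fun _ _ h =>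
  measureReal_mono fun _ hω => lt_of_le_of_lt h hω

lemma tendsto_measureReal_lt_atTop (hS : Measurable S) :
    Filter.Tendsto (fun t : ℝ => ν₀.real {ω | t < S ω}) Filter.atTop (nhds 0) := by
  have h := tendsto_measure_iInter_atTop (μ := ν₀) (s := fun t : ℝ => {ω | t < S ω})
    (fun t => (measurableSet_lt measurable_const hS).nullMeasurableSet)
    (fun _ _ h _ hω => lt_of_le_of_lt h hω) ⟨0, measure_ne_top _ _⟩
  have he : (⋂ t : ℝ, {ω | t < S ω}) = ∅ := by
    ext ω; simp only [Set.mem_iInter, Set.mem_ofPred_eq, Set.mem_empty_iff_false, iff_false]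
    intro h; exact lt_irrefl _ (h (S ω))
  rw [he, measure_empty] at h
  exact (ENNReal.tendsto_toReal ENNReal.zero_ne_top).comp h

lemma tendsto_measureReal_lt_atBot :
    Filter.Tendsto (fun t : ℝ => ν₀.real {ω | t < S ω}) Filter.atBot (nhds 1) := by
  have h := tendsto_measure_iUnion_atBot (μ := ν₀) (s := fun t : ℝ => {ω | t < S ω})
    (fun _ _ h _ hω => lt_of_le_of_lt h hω)
  have he : (⋃ t : ℝ, {ω | t < S ω}) = Set.univ := by
    ext ω; simp only [Set.mem_iUnion, Set.mem_ofPred_eq, Set.mem_univ, iff_true]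
    exact exists_lt _
  rw [he, measure_univ] at h
  exact (ENNReal.tendsto_toReal ENNReal.one_ne_top).comp h

lemma tendsto_measureReal_lt_nhdsGT (hS : Measurable S) (x : ℝ) :
    Filter.Tendsto (fun t : ℝ => ν₀.real {ω | t < S ω}) (nhdsWithin x (Set.Ioi x))
      (nhds (ν₀.real {ω | x < S ω})) := by
  have : IsProbabilityMeasure (ν₀.map S) := Measure.isProbabilityMeasure_map hS.aemeasurable
  have h := ((cdf (ν₀.map S)).right_continuous x).tendsto
  have key : ∀ t, ν₀.real {ω | t < S ω} = 1 - cdf (ν₀.map S) t := by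
    intro t
    rw [cdf_eq_real, map_measureReal_apply hS measurableSet_Iic,
      ← probReal_compl_eq_one_sub (hS measurableSet_Iic)]
    congr 1; ext ω; simp
  simp only [key]
  exact tendsto_const_nhds.sub (h.mono_left (nhdsWithin_mono _ Set.Ioi_subset_Ici_self))

lemma tendsto_measureReal_lt_nhdsLT (hS : Measurable S) (x : ℝ) :
    Filter.Tendsto (fun t : ℝ => ν₀.real {ω | t < S ω}) (nhdsWithin x (Set.Iio x))
      (nhds (ν₀.real {ω | x ≤ S ω})) := by
  have : IsProbabilityMeasure (ν₀.map S) := Measure.isProbabilityMeasure_map hS.aemeasurable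
  have h := (cdf (ν₀.map S)).mono.tendsto_leftLim x
  have key : ∀ t, ν₀.real {ω | t < S ω} = 1 - cdf (ν₀.map S) t := by
    intro t
    rw [cdf_eq_real, map_measureReal_apply hS measurableSet_Iic,
      ← probReal_compl_eq_one_sub (hS measurableSet_Iic)]
    congr 1; ext ω; simp
  have key2 : ν₀.real {ω | x ≤ S ω} = 1 - Function.leftLim (cdf (ν₀.map S)) x := by
    have h1 := (cdf (ν₀.map S)).measure_Iio (tendsto_cdf_atBot _) x
    rw [measure_cdf, Measure.map_apply hS measurableSet_Iio, sub_zero] at h1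
    have h2 : ν₀.real (S ⁻¹' Set.Iio x) = Function.leftLim (cdf (ν₀.map S)) x := by
      rw [Measure.real, h1, ENNReal.toReal_ofReal]
      exact ge_of_tendsto h (Filter.Eventually.of_forall fun t => cdf_nonneg _ t)
    rw [← h2, ← probReal_compl_eq_one_sub (hS measurableSet_Iio)]
    congr 1; ext ω; simp
  simp only [key, key2]
  exact tendsto_const_nhds.sub h

/-- Right continuity of the survival function makes the infimum attained. For `α` strictly between 0
and 1 the set of admissible thresholds is nonempty and bounded below, so `sInf` is not a default
value. -/
lemma rocThreshold_le_iff (hS : Measurable S) {α : ℝ} (hα : α ∈ Set.Ioo (0 : ℝ) 1) (y : ℝ) :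
    rocThreshold ν₀ S α ≤ y ↔ ν₀.real {ω | y < S ω} ≤ α := by
  have hne : {t : ℝ | ν₀.real {ω | t < S ω} ≤ α}.Nonempty :=
    ((tendsto_measureReal_lt_atTop ν₀ hS).eventually (Iic_mem_nhds hα.1)).exists
  have hbdd : BddBelow {t : ℝ | ν₀.real {ω | t < S ω} ≤ α} := by
    obtain ⟨t, ht⟩ := ((tendsto_measureReal_lt_atBot ν₀).eventually
      (Ioi_mem_nhds hα.2)).exists
    refine ⟨t, fun u hu => ?_⟩
    by_contra hlt
    exact absurd (lt_of_lt_of_le ht (antitone_measureReal_lt ν₀ (not_le.1 hlt).le)) (not_lt.2 hu)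
  refine ⟨fun h => ?_, fun h => csInf_le hbdd h⟩
  refine le_of_tendsto (tendsto_measureReal_lt_nhdsGT ν₀ hS y) ?_
  filter_upwards [self_mem_nhdsWithin] with t ht
  obtain ⟨u, hu, hut⟩ := exists_lt_of_csInf_lt hne (lt_of_le_of_lt h ht)
  exact (antitone_measureReal_lt ν₀ hut.le).trans hu

/-- Every `t < y` lies below the threshold, so its survival probability exceeds `α`; let `t`
increase to `y`. -/
lemma le_measureReal_of_le_rocThreshold (hS : Measurable S) {α : ℝ}
    (hα : α ∈ Set.Ioo (0 : ℝ) 1) {y : ℝ} (h : y ≤ rocThreshold ν₀ S α) :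
    α ≤ ν₀.real {ω | y ≤ S ω} := by
  refine ge_of_tendsto (tendsto_measureReal_lt_nhdsLT ν₀ hS y) ?_
  filter_upwards [self_mem_nhdsWithin] with t ht
  by_contra hlt
  exact absurd ((rocThreshold_le_iff ν₀ hS hα t).2 (not_le.1 hlt).le)
    (not_le.2 (lt_of_lt_of_le ht h))

lemma measureReal_le_eq_add (hS : Measurable S) (x : ℝ) :
    ν₀.real {ω | x ≤ S ω} = ν₀.real {ω | x < S ω} + ν₀.real {ω | S ω = x} := by
  rw [← measureReal_union]
  · congr 1; ext ω; simp only [Set.mem_ofPred_eq, Set.mem_union]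
    rw [le_iff_lt_or_eq, eq_comm]
  · rw [Set.disjoint_left]; intro ω h1 h2; exact absurd h2 (ne_of_gt h1)
  · exact measurableSet_eq_fun hS measurable_const

/-! ### The area under the ROC curve as a ranking probability -/

/-- The contribution of a positive instance with score `x` to the ROC curve at level `α`. -/
noncomputable def rocKernel (ν₀ : Measure Ω) (S : Ω → ℝ) (α x : ℝ) : ℝ :=
  -- Outside the open interval the set defining the threshold may be empty or unbounded below; the
  -- value 0 there avoids the default value of `sInf`.
  if α ∈ Set.Ioo (0 : ℝ) 1 then
    if rocThreshold ν₀ S α < x then 1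
    else if x = rocThreshold ν₀ S α then
      (α - ν₀.real {ω | x < S ω}) / ν₀.real {ω | S ω = x} else 0
  else 0

lemma rocKernel_mem_Icc (hS : Measurable S) (α x : ℝ) :
    rocKernel ν₀ S α x ∈ Set.Icc (0 : ℝ) 1 := by
  unfold rocKernel
  split_ifs with hα h1 h2
  · simp
  -- At the threshold, `α` lies between `ν₀{S > x}` and `ν₀{S ≥ x}`, whose difference is the atom in
  -- the denominator. A null atom gives the quotient 0.
  · have ha := (rocThreshold_le_iff ν₀ hS hα x).1 h2.ge
    have hb := le_measureReal_of_le_rocThreshold ν₀ hS hα h2.le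
    rw [measureReal_le_eq_add ν₀ hS] at hb
    exact ⟨div_nonneg (by linarith) measureReal_nonneg,
      div_le_one_of_le₀ (by linarith) measureReal_nonneg⟩
  · simp
  · simp

lemma measurable_rocThreshold_indicator (hS : Measurable S) :
    Measurable ((Set.Ioo (0 : ℝ) 1).indicator (rocThreshold ν₀ S)) := by
  refine measurable_of_Iic fun y => ?_
  have : (Set.Ioo (0 : ℝ) 1).indicator (rocThreshold ν₀ S) ⁻¹' Set.Iic y =
      (Set.Ioo (0 : ℝ) 1 ∩ Set.Ici (ν₀.real {ω | y < S ω})) ∪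
        ((Set.Ioo (0 : ℝ) 1)ᶜ ∩ {_α | (0 : ℝ) ≤ y}) := by
    ext α
    by_cases hα : α ∈ Set.Ioo (0 : ℝ) 1
    · simp only [Set.mem_preimage, Set.indicator_of_mem hα, Set.mem_Iic, Set.mem_union,
        Set.mem_inter_iff, hα, true_and, Set.mem_Ici, Set.mem_compl_iff, not_true, false_and,
        or_false, rocThreshold_le_iff ν₀ hS hα]
    · simp only [Set.mem_preimage, Set.indicator_of_notMem hα, Set.mem_Iic, Set.mem_union,
        Set.mem_inter_iff, hα, false_and, Set.mem_compl_iff, not_false_iff, true_and, false_or,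
        Set.mem_ofPred_eq]
  rw [this]
  exact (measurableSet_Ioo.inter measurableSet_Ici).union
    (measurableSet_Ioo.compl.inter (MeasurableSet.const _))

lemma measurable_rocKernel (hS : Measurable S) :
    Measurable (Function.uncurry (rocKernel ν₀ S)) := by
  have hT : Measurable fun q : ℝ × ℝ =>
      (Set.Ioo (0 : ℝ) 1).indicator (rocThreshold ν₀ S) q.1 :=
    (measurable_rocThreshold_indicator ν₀ hS).comp measurable_fst
  have ha : Measurable fun t : ℝ => ν₀.real {ω | t < S ω} :=
    (antitone_measureReal_lt ν₀).measurable
  have hb : Measurable fun t : ℝ => ν₀.real {ω | t ≤ S ω} :=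
    Antitone.measurable fun _ _ h => measureReal_mono fun _ hω => le_trans h hω
  have he : Measurable fun t : ℝ => ν₀.real {ω | S ω = t} := by
    have : (fun t : ℝ => ν₀.real {ω | S ω = t}) =
        fun t => ν₀.real {ω | t ≤ S ω} - ν₀.real {ω | t < S ω} := by
      ext t; rw [measureReal_le_eq_add ν₀ hS]; ring
    rw [this]; exact hb.sub ha
  have : Function.uncurry (rocKernel ν₀ S) = fun q : ℝ × ℝ =>
      if q.1 ∈ Set.Ioo (0 : ℝ) 1 then
        if (Set.Ioo (0 : ℝ) 1).indicator (rocThreshold ν₀ S) q.1 < q.2 then 1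
        else if q.2 = (Set.Ioo (0 : ℝ) 1).indicator (rocThreshold ν₀ S) q.1 then
          (q.1 - ν₀.real {ω | q.2 < S ω}) / ν₀.real {ω | S ω = q.2} else 0
      else 0 := by
    ext ⟨α, x⟩
    by_cases hα : α ∈ Set.Ioo (0 : ℝ) 1
    · simp only [Function.uncurry, rocKernel, hα, if_true, Set.indicator_of_mem hα]
    · simp only [Function.uncurry, rocKernel, hα, if_false]
  rw [this]
  refine Measurable.ite (measurable_fst measurableSet_Ioo) ?_ measurable_const
  refine Measurable.ite (measurableSet_lt hT measurable_snd) measurable_const ?_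
  exact Measurable.ite (measurableSet_eq_fun measurable_snd hT)
    ((measurable_fst.sub (ha.comp measurable_snd)).div (he.comp measurable_snd)) measurable_const

omit [IsProbabilityMeasure ν₀] in
lemma rocCurve_eq_integral (hS : Measurable S) {α : ℝ} (hα : α ∈ Set.Ioo (0 : ℝ) 1) :
    rocCurve ν₀ ν₁ S α = ∫ ω, rocKernel ν₀ S α (S ω) ∂ν₁ := by
  have h1 : MeasurableSet {ω | rocThreshold ν₀ S α < S ω} := measurableSet_lt measurable_const hS
  have h2 : MeasurableSet {ω | S ω = rocThreshold ν₀ S α} :=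
    measurableSet_eq_fun hS measurable_const
  set t := rocThreshold ν₀ S α with ht
  have : (fun ω => rocKernel ν₀ S α (S ω)) = fun ω =>
      {ω | t < S ω}.indicator (fun _ => (1 : ℝ)) ω +
      {ω | S ω = t}.indicator
        (fun _ => (α - ν₀.real {ω | t < S ω}) / ν₀.real {ω | S ω = t}) ω := by
    ext ω
    simp only [rocKernel, hα, if_true, ← ht, Set.indicator, Set.mem_ofPred_eq]
    rcases lt_trichotomy t (S ω) with h | h | h
    · simp [h, h.ne']
    · simp [← h]
    · simp [h.not_gt, h.ne]
  rw [this, integral_add ((integrable_const _).indicator h1) ((integrable_const _).indicator h2),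
    integral_indicator_const _ h1, integral_indicator_const _ h2]
  simp only [rocCurve, ← ht, smul_eq_mul]
  ring

/-- As a function of `α`, the kernel is 0 up to `a = ν₀{S > x}`, rises linearly to 1 across the atom
of mass `e`, and stays at 1. The ramp has area `e / 2`, which is where the half weight of ties comes
from. -/
lemma integral_rocKernel (hS : Measurable S) (x : ℝ) :
    ∫ α in Set.Ioo (0 : ℝ) 1, rocKernel ν₀ S α x = ∫ ω, rankKernel x (S ω) ∂ν₀ := by
  set a := ν₀.real {ω | x < S ω} with ha
  set e := ν₀.real {ω | S ω = x} with he
  have hb : ν₀.real {ω | x ≤ S ω} = a + e := measureReal_le_eq_add ν₀ hS x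
  have ha0 : 0 ≤ a := measureReal_nonneg
  have he0 : 0 ≤ e := measureReal_nonneg
  have hb1 : a + e ≤ 1 := hb ▸ measureReal_le_one
  have hL : ν₀.real {ω | S ω < x} = 1 - (a + e) := by
    rw [← hb, ← probReal_compl_eq_one_sub (measurableSet_le measurable_const hS)]
    congr 1; ext ω; simp
  have hR : ∫ ω, rankKernel x (S ω) ∂ν₀ = 1 - (a + e) + e / 2 := by
    have h1 : MeasurableSet {ω | S ω < x} := measurableSet_lt hS measurable_const
    have h2 : MeasurableSet {ω | S ω = x} := measurableSet_eq_fun hS measurable_const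
    have : (fun ω => rankKernel x (S ω)) = fun ω =>
        {ω | S ω < x}.indicator (fun _ => (1 : ℝ)) ω +
        {ω | S ω = x}.indicator (fun _ => (1 / 2 : ℝ)) ω := by
      ext ω
      simp only [rankKernel, Set.indicator, Set.mem_ofPred_eq]
      rcases lt_trichotomy (S ω) x with h | h | h
      · simp [h, h.ne]
      · simp [h]
      · simp [h.not_gt, h.ne, h.ne']
    rw [this, integral_add ((integrable_const _).indicator h1)
      ((integrable_const _).indicator h2), integral_indicator_const _ h1,
      integral_indicator_const _ h2, hL, ← he]
    simp only [smul_eq_mul]; ring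
  have hK : ∀ᵐ α ∂(volume.restrict (Set.Ioo (0 : ℝ) 1)), rocKernel ν₀ S α x =
      (Set.Ioc (a + e) 1).indicator (fun _ => (1 : ℝ)) α +
      (Set.Ioc a (a + e)).indicator (fun α => (α - a) / e) α := by
    -- Discarding the two break points makes the weak inequalities on `α` strict.
    have hn : ∀ᵐ α ∂(volume.restrict (Set.Ioo (0 : ℝ) 1)), α ≠ a ∧ α ≠ a + e :=
      ae_restrict_of_ae ((Measure.ae_ne volume a).and (Measure.ae_ne volume (a + e)))
    filter_upwards [hn, ae_restrict_mem measurableSet_Ioo] with α hα hα1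
    simp only [rocKernel, hα1, if_true, ← ha, ← he, Set.indicator, Set.mem_Ioc]
    have hle := rocThreshold_le_iff ν₀ hS hα1 x
    rw [← ha] at hle
    rcases lt_trichotomy (rocThreshold ν₀ S α) x with h | h | h
    · have h3 : a + e ≤ α := by
        rw [← hb]
        refine le_trans ?_ ((rocThreshold_le_iff ν₀ hS hα1 _).1 le_rfl)
        exact measureReal_mono fun ω hω => lt_of_lt_of_le h hω
      have h4 : a + e < α := lt_of_le_of_ne h3 (Ne.symm hα.2)
      simp [h, h4, hα1.2.le, h4.not_ge]
    · have h3 : α ≤ a + e := hb ▸ le_measureReal_of_le_rocThreshold ν₀ hS hα1 h.ge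
      have h4 : a < α := lt_of_le_of_ne (hle.1 h.le) (Ne.symm hα.1)
      simp [h, h3, h4, h3.not_gt]
    · have h3 : α < a := not_le.1 fun h' => absurd (hle.2 h') (not_le.2 h)
      have h4 : α < a + e := by linarith
      simp [h.not_gt, h.ne, h3.not_gt, h4.not_gt]
  rw [integral_congr_ae hK, hR, ← integral_Ioc_eq_integral_Ioo]
  have hI : IntegrableOn (fun α => (α - a) / e) (Set.Ioc a (a + e)) volume :=
    (((continuous_id.sub continuous_const).div_const e).integrableOn_Icc).mono_set
      Set.Ioc_subset_Icc_self
  rw [integral_add]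
  · rw [setIntegral_indicator measurableSet_Ioc, setIntegral_indicator measurableSet_Ioc,
      Set.inter_eq_right.2 (Set.Ioc_subset_Ioc (by linarith) le_rfl),
      Set.inter_eq_right.2 (Set.Ioc_subset_Ioc ha0 hb1),
      ← intervalIntegral.integral_of_le hb1, ← intervalIntegral.integral_of_le (by linarith),
      intervalIntegral.integral_div, intervalIntegral.integral_sub
        intervalIntegral.intervalIntegrable_id intervalIntegrable_const]
    simp only [intervalIntegral.integral_const, smul_eq_mul, integral_id]
    congr 1
    · ring
    · rcases he0.eq_or_lt with h | h
      · rw [← h]; simp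
      · field_simp; ring
  · exact (integrable_const _).indicator measurableSet_Ioc
  · exact ((integrable_indicator_iff measurableSet_Ioc).2 hI).restrict

/-- The area under the ROC curve is the probability that a positive instance outranks a negative
one, ties counting one half. -/
lemma integral_rocCurve (hS : Measurable S) :
    ∫ α in (0 : ℝ)..1, rocCurve ν₀ ν₁ S α = ∫ ω, ∫ ω', rankKernel (S ω) (S ω') ∂ν₀ ∂ν₁ := by
  rw [intervalIntegral.integral_of_le zero_le_one, integral_Ioc_eq_integral_Ioo,
    setIntegral_congr_fun measurableSet_Ioo fun α hα => rocCurve_eq_integral ν₀ ν₁ hS hα,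
    integral_integral_swap]
  · simp only [integral_rocKernel ν₀ hS]
  · refine Integrable.of_bound (C := 1) ?_ (Filter.Eventually.of_forall fun q => ?_)
    · exact ((measurable_rocKernel ν₀ hS).comp
        (measurable_fst.prodMk (hS.comp measurable_snd))).aestronglyMeasurable
    · have := rocKernel_mem_Icc ν₀ hS q.1 (S q.2)
      exact abs_le.2 ⟨(by norm_num : (-1 : ℝ) ≤ 0).trans this.1, this.2⟩

end ROC

/-! ### Regret of a score: AUC loss against mean deviation from `η` -/

section Ranking

variable {Ω : Type*} [MeasurableSpace Ω]

/-- The left side is nonzero only if `t ≠ t'` and `s, s'` fail to reproduce their strict order. If,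
say, `t' < t` and `s ≤ s'`, then `t - t' ≤ (t - s) + (s' - t')`. -/
lemma rankKernel_sub_mul_le (t t' s s' : ℝ) :
    (rankKernel t t' - rankKernel s s') * (t - t') ≤ |t - s| + |t' - s'| := by
  have h1 := le_abs_self (t - s)
  have h2 := neg_abs_le (t - s)
  have h3 := le_abs_self (t' - s')
  have h4 := neg_abs_le (t' - s')
  have h5 := abs_nonneg (t - s)
  have h6 := abs_nonneg (t' - s')
  unfold rankKernel
  split_ifs <;> linarith

/-- Mis-ranking costs at most the mean deviation of the score from the regression function. -/
lemma integral_rankKernel_sub_le (P : Measure Ω) [IsProbabilityMeasure P] {S T : Ω → ℝ}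
    (hS : Measurable S) (hT : Measurable T) (hT0 : ∀ ω, T ω ∈ Set.Icc (0 : ℝ) 1)
    (hi : Integrable (fun ω => |T ω - S ω|) P) :
    ∫ ω, (∫ ω', rankKernel (T ω) (T ω') * (1 - T ω') ∂P) * T ω ∂P -
      ∫ ω, (∫ ω', rankKernel (S ω) (S ω') * (1 - T ω') ∂P) * T ω ∂P ≤
      ∫ ω, |T ω - S ω| ∂P := by
  have hw : ∀ {U : Ω → ℝ}, Measurable U →
      Measurable fun z : Ω × Ω => rankKernel (U z.1) (U z.2) := fun hU =>
    measurable_rankKernel.comp ((hU.comp measurable_fst).prodMk (hU.comp measurable_snd))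
  have hT1 : Measurable fun z : Ω × Ω => T z.1 := hT.comp measurable_fst
  have hT2 : Measurable fun z : Ω × Ω => T z.2 := hT.comp measurable_snd
  have hb : ∀ {f : Ω × Ω → ℝ}, Measurable f → (∀ z, |f z| ≤ 1) → Integrable f (P.prod P) :=
    fun hf h => Integrable.of_bound hf.aestronglyMeasurable 1 (Filter.Eventually.of_forall h)
  have habs : ∀ {x : ℝ}, x ∈ Set.Icc (0 : ℝ) 1 → |x| ≤ 1 := fun h =>
    abs_le.2 ⟨(by norm_num : (-1 : ℝ) ≤ 0).trans h.1, h.2⟩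
  have hT0' : ∀ ω, 1 - T ω ∈ Set.Icc (0 : ℝ) 1 := fun ω =>
    ⟨by linarith [(hT0 ω).2], by linarith [(hT0 ω).1]⟩
  have hint : ∀ {U : Ω → ℝ}, Measurable U → Integrable
      (fun z : Ω × Ω => rankKernel (U z.1) (U z.2) * (1 - T z.2) * T z.1) (P.prod P) := by
    intro U hU
    refine hb (((hw hU).mul (measurable_const.sub hT2)).mul hT1) fun z => ?_
    rw [abs_mul, abs_mul]
    exact mul_le_one₀ (mul_le_one₀ (abs_rankKernel_le_one _ _) (abs_nonneg _)
      (habs (hT0' _))) (abs_nonneg _) (habs (hT0 _))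
  have hprod : ∀ {U : Ω → ℝ}, Measurable U →
      ∫ ω, (∫ ω', rankKernel (U ω) (U ω') * (1 - T ω') ∂P) * T ω ∂P =
      ∫ z, rankKernel (U z.1) (U z.2) * (1 - T z.2) * T z.1 ∂(P.prod P) := by
    intro U hU
    rw [integral_prod _ (hint hU)]
    simp only [integral_mul_const]
  rw [hprod hT, hprod hS, ← integral_sub (hint hT) (hint hS)]
  set d : Ω × Ω → ℝ := fun z => rankKernel (T z.1) (T z.2) - rankKernel (S z.1) (S z.2) with hd
  have hds : ∀ z : Ω × Ω, d z.swap = - d z := by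
    intro z
    have h1 := rankKernel_add_swap (T z.1) (T z.2)
    have h2 := rankKernel_add_swap (S z.1) (S z.2)
    simp only [hd, Prod.fst_swap, Prod.snd_swap]; linarith
  have e1 : ∀ z : Ω × Ω, rankKernel (T z.1) (T z.2) * (1 - T z.2) * T z.1 -
      rankKernel (S z.1) (S z.2) * (1 - T z.2) * T z.1 = d z * (1 - T z.2) * T z.1 := by
    intro z; simp only [hd]; ring
  simp only [e1]
  have i1 : Integrable (fun z : Ω × Ω => d z * (1 - T z.2) * T z.1) (P.prod P) :=
    ((hint hT).sub (hint hS)).congr (Filter.Eventually.of_forall e1)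
  have i2 : Integrable (fun z : Ω × Ω => |T z.1 - S z.1|) (P.prod P) := hi.comp_fst P
  have i3 : Integrable (fun z : Ω × Ω => |T z.2 - S z.2|) (P.prod P) := hi.comp_snd P
  have e2 : ∫ z, d z * (1 - T z.2) * T z.1 ∂(P.prod P) =
      ∫ z : Ω × Ω, - d z * (1 - T z.1) * T z.2 ∂(P.prod P) := by
    rw [← integral_prod_swap]
    simp only [hds, Prod.fst_swap, Prod.snd_swap]
  have i4 : Integrable (fun z : Ω × Ω => - d z * (1 - T z.1) * T z.2) (P.prod P) := by
    refine i1.swap.congr (Filter.Eventually.of_forall fun z => ?_)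
    simp only [Function.comp_apply, hds, Prod.fst_swap, Prod.snd_swap]
  -- Averaging over the exchange of the two copies: since `d` is antisymmetric, the weights combine
  -- to `(1 - T')T - (1 - T)T' = T - T'`, and the pointwise bound applies.
  have e3 : (∫ z, d z * (1 - T z.2) * T z.1 ∂(P.prod P)) +
      ∫ z, d z * (1 - T z.2) * T z.1 ∂(P.prod P) ≤
      (∫ ω, |T ω - S ω| ∂P) + ∫ ω, |T ω - S ω| ∂P := by
    nth_rewrite 2 [e2]
    rw [← integral_add i1 i4]
    have f1 : ∫ ω, |T ω - S ω| ∂P = ∫ z, |T z.1 - S z.1| ∂(P.prod P) := by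
      rw [integral_fun_fst (fun ω => |T ω - S ω|)]; simp
    have f2 : ∫ ω, |T ω - S ω| ∂P = ∫ z, |T z.2 - S z.2| ∂(P.prod P) := by
      rw [integral_fun_snd (fun ω => |T ω - S ω|)]; simp
    nth_rewrite 1 [f1]
    rw [f2, ← integral_add i2 i3]
    refine integral_mono (i1.add i4) (i2.add i3) fun z => ?_
    have := rankKernel_sub_mul_le (T z.1) (T z.2) (S z.1) (S z.2)
    simp only [hd]
    linarith
  linarith

namespace RankingModel

variable {P : Measure Ω} [IsProbabilityMeasure P] (D : RankingModel P)

/-- The σ-algebra generated by the random curve. -/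
noncomputable abbrev pathSigma : MeasurableSpace Ω := MeasurableSpace.comap D.path (borel L2I)

omit [IsProbabilityMeasure P] in
lemma pathSigma_le : D.pathSigma ≤ ‹MeasurableSpace Ω› := D.measurable_path.comap_le

omit [IsProbabilityMeasure P] in
lemma measurable_comp_path {h : L2I → ℝ} (hh : Continuous h) :
    Measurable[D.pathSigma] fun ω => h (D.path ω) := by
  let : MeasurableSpace L2I := borel L2I
  have : BorelSpace L2I := ⟨rfl⟩
  exact hh.measurable.comp (comap_measurable _)

omit [IsProbabilityMeasure P] in
lemma η_path_mem (ω : Ω) : D.η (D.path ω) ∈ Set.Icc (0 : ℝ) 1 :=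
  D.η_mem _ (D.mem_paths ω)

omit [IsProbabilityMeasure P] in
lemma measurableSet_label (c : ℤ) : MeasurableSet {ω | D.Y ω = c} :=
  D.measurable_Y (measurableSet_singleton c)

/-- A bounded function of the curve can be pulled out of the conditional expectation, which replaces
the label indicator by `η`. -/
lemma setIntegral_pos_label {F : Ω → ℝ} (hF : Measurable[D.pathSigma] F)
    (hb : ∀ ω, |F ω| ≤ 1) :
    ∫ ω in {ω | D.Y ω = 1}, F ω ∂P = ∫ ω, F ω * D.η (D.path ω) ∂P := by
  have hm := D.pathSigma_le
  have hg : Integrable (Set.indicator {ω | D.Y ω = 1} (fun _ => (1 : ℝ))) P :=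
    (integrable_const _).indicator (D.measurableSet_label 1)
  have h1 := condExp_stronglyMeasurable_mul_of_bound hm hF.stronglyMeasurable hg 1
    (Filter.Eventually.of_forall hb)
  have h2 : ∫ ω, (F * Set.indicator {ω | D.Y ω = 1} (fun _ => (1 : ℝ))) ω ∂P =
      ∫ ω, F ω * D.η (D.path ω) ∂P := by
    rw [← integral_condExp hm]
    refine integral_congr_ae (h1.trans ?_)
    filter_upwards [D.η_spec] with ω hω
    simp only [Pi.mul_apply]
    congr 1
  rw [← h2, ← integral_indicator (D.measurableSet_label 1)]
  congr 1; ext ω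
  simp [Set.indicator]

lemma setIntegral_neg_label {F : Ω → ℝ} (hF : Measurable[D.pathSigma] F)
    (hb : ∀ ω, |F ω| ≤ 1) (hη : Measurable[D.pathSigma] fun ω => D.η (D.path ω)) :
    ∫ ω in {ω | D.Y ω = -1}, F ω ∂P = ∫ ω, F ω * (1 - D.η (D.path ω)) ∂P := by
  have hm := D.pathSigma_le
  have hFi : Integrable F P := Integrable.of_bound (hF.mono hm le_rfl).aestronglyMeasurable 1
    (Filter.Eventually.of_forall hb)
  have hFη : Integrable (fun ω => F ω * D.η (D.path ω)) P := by
    refine Integrable.of_bound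
      ((hF.mono hm le_rfl).mul (hη.mono hm le_rfl)).aestronglyMeasurable 1
      (Filter.Eventually.of_forall fun ω => ?_)
    have h := D.η_path_mem ω
    rw [norm_mul]
    exact mul_le_one₀ (hb ω) (norm_nonneg _)
      (abs_le.2 ⟨(by norm_num : (-1 : ℝ) ≤ 0).trans h.1, h.2⟩)
  have hc : {ω | D.Y ω = -1} = {ω | D.Y ω = 1}ᶜ := by
    ext ω
    simp only [Set.mem_ofPred_eq, Set.mem_compl_iff]
    rcases D.label ω with h | h <;> rw [h] <;> norm_num
  have h := integral_add_compl (D.measurableSet_label 1) hFi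
  rw [D.setIntegral_pos_label hF hb] at h
  simp only [mul_sub, mul_one]
  rw [integral_sub hFi hFη, hc]
  linarith

/-- The normalising constant `P(Y = 1) P(Y = -1)`. -/
noncomputable def labelProd : ℝ := P.real {ω | D.Y ω = 1} * P.real {ω | D.Y ω = -1}

lemma labelProd_pos : 0 < D.labelProd :=
  mul_pos (ENNReal.toReal_pos D.pos_pos.ne' (measure_ne_top _ _))
    (ENNReal.toReal_pos D.neg_pos.ne' (measure_ne_top _ _))

/-- On functions of the curve, the laws conditional on the label have densities proportional to `η`
and `1 - η`. Measurability of `η(X)` is a hypothesis because `η_spec` identifies it only almost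
everywhere; later it follows from the Lipschitz property. -/
lemma auc_eq {S : Ω → ℝ} (hS : Measurable[D.pathSigma] S)
    (hη : Measurable[D.pathSigma] fun ω => D.η (D.path ω)) :
    auc P D.Y S = D.labelProd⁻¹ * ∫ ω, (∫ ω', rankKernel (S ω) (S ω') *
      (1 - D.η (D.path ω')) ∂P) * D.η (D.path ω) ∂P := by
  have hm := D.pathSigma_le
  have hS' := hS.mono hm le_rfl
  have : IsProbabilityMeasure (P[|{ω | D.Y ω = -1}]) := cond_isProbabilityMeasure D.neg_pos.ne'
  have : IsProbabilityMeasure (P[|{ω | D.Y ω = 1}]) := cond_isProbabilityMeasure D.pos_pos.ne'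
  rw [auc, integral_rocCurve _ _ hS']
  have h1 : ∀ x, ∫ ω', rankKernel x (S ω') ∂(P[|{ω | D.Y ω = -1}]) =
      (P.real {ω | D.Y ω = -1})⁻¹ * ∫ ω', rankKernel x (S ω') * (1 - D.η (D.path ω')) ∂P := by
    intro x
    rw [ProbabilityTheory.cond, integral_smul_measure, D.setIntegral_neg_label
      (F := fun ω => rankKernel x (S ω))
      ((measurable_rankKernel.comp (measurable_const.prodMk measurable_id)).comp hS)
      (fun ω => abs_rankKernel_le_one _ _) hη]
    simp [Measure.real, ENNReal.toReal_inv]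
  set G : ℝ → ℝ := fun x => ∫ ω', rankKernel x (S ω') * (1 - D.η (D.path ω')) ∂P with hG
  have hGm : Measurable G := by
    refine StronglyMeasurable.measurable ?_
    refine StronglyMeasurable.integral_prod_right
      (f := fun x ω' => rankKernel x (S ω') * (1 - D.η (D.path ω'))) ?_
    exact ((measurable_rankKernel.comp (measurable_fst.prodMk (hS'.comp measurable_snd))).mul
      (measurable_const.sub ((hη.mono hm le_rfl).comp measurable_snd))).stronglyMeasurable
  have hGb : ∀ x, |G x| ≤ 1 := by
    intro x
    have := norm_integral_le_of_norm_le_const (μ := P) (C := 1)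
      (f := fun ω' => rankKernel x (S ω') * (1 - D.η (D.path ω')))
      (Filter.Eventually.of_forall fun ω' => by
        have h := D.η_path_mem ω'
        rw [norm_mul]
        exact mul_le_one₀ (abs_rankKernel_le_one _ _) (norm_nonneg _)
          (abs_le.2 ⟨by have := h.2; linarith, by have := h.1; linarith⟩))
    simpa using this
  simp only [h1]
  rw [integral_const_mul, ProbabilityTheory.cond, integral_smul_measure,
    D.setIntegral_pos_label (F := fun ω => G (S ω)) (hGm.comp hS) (fun ω => hGb _), labelProd, mul_inv]
  simp only [ENNReal.toReal_inv, smul_eq_mul]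
  change _ * ((P.real _)⁻¹ * _) = _
  ring

lemma aucStar_sub_auc_le {h : L2I → ℝ} (hh : Continuous h)
    (hη : Measurable[D.pathSigma] fun ω => D.η (D.path ω))
    (hi : Integrable (fun ω => |D.η (D.path ω) - h (D.path ω)|) P) :
    D.aucStar - auc P D.Y (fun ω => h (D.path ω)) ≤
      D.labelProd⁻¹ * ∫ ω, |D.η (D.path ω) - h (D.path ω)| ∂P := by
  have hm := D.pathSigma_le
  have hS := D.measurable_comp_path hh
  rw [aucStar, D.auc_eq hη hη, D.auc_eq hS hη, ← mul_sub]
  exact mul_le_mul_of_nonneg_left (integral_rankKernel_sub_le P (hS.mono hm le_rfl)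
    (hη.mono hm le_rfl) D.η_path_mem hi)
    (inv_nonneg.2 D.labelProd_pos.le)

-- The upper bound makes the real supremum in `optimalAUC` a genuine one, so that each score is a
-- lower bound for it.
omit [IsProbabilityMeasure P] in
lemma auc_mem_Icc [IsFiniteMeasure P] {S : Ω → ℝ} (hS : Measurable S) :
    auc P D.Y S ∈ Set.Icc (0 : ℝ) 1 := by
  have : IsProbabilityMeasure (P[|{ω | D.Y ω = -1}]) := cond_isProbabilityMeasure D.neg_pos.ne'
  have : IsProbabilityMeasure (P[|{ω | D.Y ω = 1}]) := cond_isProbabilityMeasure D.pos_pos.ne'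
  rw [auc, integral_rocCurve _ _ hS]
  have h0 : ∀ x, 0 ≤ ∫ ω', rankKernel x (S ω') ∂(P[|{ω | D.Y ω = -1}]) := fun x =>
    integral_nonneg fun ω' => rankKernel_nonneg _ _
  have h1 : ∀ x, ‖∫ ω', rankKernel x (S ω') ∂(P[|{ω | D.Y ω = -1}])‖ ≤ 1 := fun x => by
    simpa using norm_integral_le_of_norm_le_const (C := 1) (μ := P[|{ω | D.Y ω = -1}])
      (f := fun ω' => rankKernel x (S ω'))
      (Filter.Eventually.of_forall fun ω' => abs_rankKernel_le_one x (S ω'))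
  refine ⟨integral_nonneg fun ω => h0 _, (le_abs_self _).trans ?_⟩
  simpa using norm_integral_le_of_norm_le_const (C := 1) (μ := P[|{ω | D.Y ω = 1}])
    (Filter.Eventually.of_forall fun ω => h1 (S ω))

end RankingModel
end Ranking

/-! ### From AUC loss to the omitted coefficients -/

section Truncation

/-- Parseval's inequality for the remainder of a finite partial expansion in a Hilbert basis. -/
lemma HilbertBasis.enorm_sub_sum_sq_le {ι E κ : Type*} [NormedAddCommGroup E]
    [InnerProductSpace ℝ E] [Fintype κ] (b : HilbertBasis ι ℝ E) {e : κ → ι}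
    (he : Function.Injective e) (x : E) :
    ‖x - ∑ k, inner ℝ (b (e k)) x • b (e k)‖ₑ ^ 2 ≤
      ∑' i : ((Set.range e)ᶜ : Set ι), ‖inner ℝ (b i) x‖ₑ ^ 2 := by
  classical
  set y := x - ∑ k, inner ℝ (b (e k)) x • b (e k) with hy
  have ho := orthonormal_iff_ite.1 b.orthonormal
  have h1 : ∀ i, inner ℝ (b i) y =
      ((Set.range e)ᶜ : Set ι).indicator (fun i => inner ℝ (b i) x) i := by
    intro i
    rw [hy, inner_sub_right, inner_sum]
    simp only [inner_smul_right, ho, mul_ite, mul_one, mul_zero]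
    by_cases hi : i ∈ Set.range e
    · obtain ⟨k, rfl⟩ := hi
      simp [he.eq_iff]
    · rw [Set.indicator_of_mem (by simpa using hi), Finset.sum_eq_zero, sub_zero]
      intro k _
      rw [if_neg]
      rintro rfl
      exact hi ⟨k, rfl⟩
  have h2 := b.hasSum_inner_mul_inner y y
  have h3 : ‖y‖ₑ ^ 2 = ENNReal.ofReal (inner ℝ y y) := by
    rw [real_inner_self_eq_norm_sq, ENNReal.ofReal_pow (norm_nonneg _), ofReal_norm]
  rw [h3, ← h2.tsum_eq, ENNReal.ofReal_tsum_of_nonneg _ h2.summable,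
    tsum_subtype ((Set.range e)ᶜ) fun i => ‖inner ℝ (b i) x‖ₑ ^ 2]
  · refine ENNReal.tsum_le_tsum fun i => le_of_eq ?_
    rw [real_inner_comm, ← pow_two, ← sq_abs, ENNReal.ofReal_pow (abs_nonneg _),
      ← Real.norm_eq_abs, ofReal_norm, h1]
    by_cases hi : i ∈ ((Set.range e)ᶜ : Set ι)
    · simp only [Set.indicator_of_mem hi]
    · simp [Set.indicator_of_notMem hi]
  · intro i
    rw [real_inner_comm]; exact mul_self_nonneg _

namespace RankingModel

variable {Ω : Type*} [MeasurableSpace Ω] {P : Measure Ω} (D : RankingModel P)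

lemma coeff_eq_inner {g : ℝ → ℝ} {f : L2I}
    (h : (f : unitInterval → ℝ) =ᵐ[volume] fun t : unitInterval => g t) (ω : Ω) :
    D.coeff g ω = inner ℝ f (D.path ω) := by
  rw [L2.inner_def, coeff]
  refine integral_congr_ae ?_
  filter_upwards [h, (D.memLp_X ω).coeFn_toLp] with t h1 h2
  rw [path, h1, h2]
  simp

variable [IsProbabilityMeasure P]

lemma auc_le_optimalAUC {κ : Type} {Z : Ω → κ → ℝ} (hZ : Measurable Z)
    {s : (κ → ℝ) → ℝ} (hs : Measurable s) :
    auc P D.Y (fun ω => s (Z ω)) ≤ optimalAUC P D.Y Z := by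
  refine le_ciSup (f := fun s : {s : (κ → ℝ) → ℝ // Measurable s} =>
    auc P D.Y fun ω => s.1 (Z ω)) ⟨1, ?_⟩ ⟨s, hs⟩
  rintro _ ⟨s, rfl⟩
  exact (D.auc_mem_Icc (s.2.comp hZ)).2

/-- The loss of AUC caused by a truncation of the path is controlled by the mean square of the
omitted coefficients. -/
lemma exists_aucStar_sub_optimalAUC_le (hη : ∃ K : ℝ≥0, LipschitzOnWith K D.η D.paths) :
    ∃ C : ℝ, 0 ≤ C ∧ ∀ {ι κ : Type} [Countable ι] [Fintype κ] {g : ι → ℝ → ℝ},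
      IsOrthonormalBasisL2I g → ∀ {e : κ → ι}, Function.Injective e → ∀ {B : ℝ}, 0 ≤ B →
      ∑' i : ((Set.range e)ᶜ : Set ι), D.coeffMoment (g i) ≤ ENNReal.ofReal (B ^ 2) →
      D.aucStar - optimalAUC P D.Y (fun ω k => D.coeff (g (e k)) ω) ≤ C * B := by
  obtain ⟨K, hK⟩ := hη
  -- The truncated expansion may leave `D.paths`, so `η` is extended to all of `L²` with the same
  -- Lipschitz constant.
  obtain ⟨η', hη', heq⟩ := hK.extend_real
  have hηeq : ∀ ω, D.η (D.path ω) = η' (D.path ω) := fun ω => heq (D.mem_paths ω)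
  have hηm : Measurable[D.pathSigma] fun ω => D.η (D.path ω) := by
    simp only [hηeq]; exact D.measurable_comp_path hη'.continuous
  refine ⟨D.labelProd⁻¹ * K, mul_nonneg (inv_nonneg.2 D.labelProd_pos.le) K.2, ?_⟩
  intro ι κ _ _ g hg e he B hB htail
  obtain ⟨b, hb⟩ := hg
  have hm := D.pathSigma_le
  have hc : ∀ i ω, D.coeff (g i) ω = inner ℝ (b i) (D.path ω) := fun i =>
    D.coeff_eq_inner (hb i)
  have hcm : ∀ i, Measurable fun ω => D.coeff (g i) ω := fun i => by
    simp only [hc]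
    exact (D.measurable_comp_path (continuous_const.inner continuous_id)).mono hm le_rfl
  set T : L2I → L2I := fun x => ∑ k, inner ℝ (b (e k)) x • b (e k) with hT
  have hTc : Continuous T := continuous_finsetSum _ fun k _ => by fun_prop
  -- The competing score: rebuild the truncated curve from its coefficients and apply `η'`.
  have hs : Continuous fun z : κ → ℝ => η' (∑ k, z k • b (e k)) :=
    hη'.continuous.comp (continuous_finsetSum _ fun k _ =>
      (continuous_apply k).smul continuous_const)
  have hopt := D.auc_le_optimalAUC (Z := fun ω k => D.coeff (g (e k)) ω)
    (measurable_pi_lambda _ fun k => hcm (e k)) hs.measurable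
  have hsT : (fun ω => η' (∑ k, D.coeff (g (e k)) ω • b (e k))) =
      fun ω => η' (T (D.path ω)) := by
    ext ω; simp only [hT, hc]
  rw [hsT] at hopt
  have hnm : Measurable fun ω => ‖D.path ω - T (D.path ω)‖ :=
    (D.measurable_comp_path (continuous_id.sub hTc).norm).mono hm le_rfl
  have h2 : ∫⁻ ω, ‖‖D.path ω - T (D.path ω)‖‖ₑ ^ 2 ∂P ≤ ENNReal.ofReal (B ^ 2) := by
    refine le_trans ?_ htail
    simp only [coeffMoment]
    rw [← lintegral_tsum fun i : ((Set.range e)ᶜ : Set ι) => ((hcm i).enorm.pow_const 2).aemeasurable]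
    refine lintegral_mono fun ω => ?_
    simp only [enorm_norm, hc]
    exact b.enorm_sub_sum_sq_le he _
  have hL2 : eLpNorm (fun ω => ‖D.path ω - T (D.path ω)‖) 2 P ≤ ENNReal.ofReal B := by
    rw [eLpNorm_eq_lintegral_rpow_enorm_toReal two_ne_zero ENNReal.ofNat_ne_top]
    simp only [ENNReal.toReal_ofNat, ENNReal.rpow_ofNat]
    refine (ENNReal.rpow_le_rpow h2 (by norm_num)).trans (le_of_eq ?_)
    rw [ENNReal.ofReal_rpow_of_nonneg (sq_nonneg _) (by norm_num), ← Real.sqrt_eq_rpow,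
      Real.sqrt_sq hB]
  -- On a probability space the `L¹` norm is at most the `L²` norm, here of the truncation error.
  have hL1 := (eLpNorm_le_eLpNorm_of_exponent_le one_le_two hnm.aestronglyMeasurable).trans hL2
  have hni : Integrable (fun ω => ‖D.path ω - T (D.path ω)‖) P :=
    memLp_one_iff_integrable.1 ⟨hnm.aestronglyMeasurable, hL1.trans_lt ENNReal.ofReal_lt_top⟩
  have hnB : ∫ ω, ‖D.path ω - T (D.path ω)‖ ∂P ≤ B := by
    rw [← ENNReal.ofReal_le_ofReal_iff hB, ofReal_integral_eq_lintegral_ofReal hni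
      (Filter.Eventually.of_forall fun ω => norm_nonneg _)]
    refine le_trans (le_of_eq ?_) hL1
    rw [eLpNorm_one_eq_lintegral_enorm]
    simp only [enorm_norm, ofReal_norm]
  have hle : ∀ ω, |D.η (D.path ω) - η' (T (D.path ω))| ≤ K * ‖D.path ω - T (D.path ω)‖ := by
    intro ω
    rw [hηeq, ← Real.dist_eq, ← dist_eq_norm]
    exact hη'.dist_le_mul _ _
  have hi : Integrable (fun ω => |D.η (D.path ω) - η' (T (D.path ω))|) P := by
    refine (hni.const_mul (K : ℝ)).mono' ?_ (Filter.Eventually.of_forall fun ω => ?_)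
    · simp only [hηeq]
      exact ((D.measurable_comp_path (hη'.continuous.sub
        (hη'.continuous.comp hTc)).abs).mono hm le_rfl).aestronglyMeasurable
    · rw [Real.norm_eq_abs, abs_abs]; exact hle ω
  have hmain := D.aucStar_sub_auc_le (h := fun x => η' (T x)) (hη'.continuous.comp hTc) hηm hi
  calc D.aucStar - optimalAUC P D.Y (fun ω k => D.coeff (g (e k)) ω)
      ≤ D.aucStar - auc P D.Y (fun ω => η' (T (D.path ω))) := by linarith
    _ ≤ D.labelProd⁻¹ * ∫ ω, |D.η (D.path ω) - η' (T (D.path ω))| ∂P := hmain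
    _ ≤ D.labelProd⁻¹ * (K * B) := by
        refine mul_le_mul_of_nonneg_left ?_ (inv_nonneg.2 D.labelProd_pos.le)
        refine (integral_mono hi (hni.const_mul (K : ℝ)) hle).trans ?_
        rw [integral_const_mul]
        exact mul_le_mul_of_nonneg_left hnB K.2
    _ = D.labelProd⁻¹ * K * B := by ring

end RankingModel
end Truncation

/-! ### Stechkin's estimate, supports and vanishing moments -/

section Rates

/-- Stechkin's estimate: the `ℓ¹` tail beyond the `N` largest terms of an `ℓ^q` sequence,
`q = 1 / (1 + s)`. -/
lemma ENNReal.tsum_compl_le_of_largest {ι : Type*} {a : ι → ℝ≥0∞} {q s : ℝ} (hs : 0 < s)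
    (hq : q = 1 / (1 + s)) (I : Finset ι) (hI : 1 ≤ I.card)
    (hmax : ∀ i ∈ I, ∀ i' ∉ I, a i' ≤ a i) :
    ∑' i : ((I : Set ι)ᶜ : Set ι), a i ≤
      (∑' i, a i ^ q) * ((∑' i, a i ^ q) / I.card) ^ s := by
  have hq0 : 0 < q := by rw [hq]; positivity
  set A := ∑' i, a i ^ q with hA
  -- Each of the `I.card` terms kept is at least the omitted one, and together their `q`-th powers
  -- sum to at most `A`.
  have hle : ∀ i' ∉ I, a i' ^ q ≤ A / I.card := by
    intro i' hi'
    rw [ENNReal.le_div_iff_mul_le (Or.inl (by exact_mod_cast (by omega : I.card ≠ 0)))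
      (Or.inl (ENNReal.natCast_ne_top _)), mul_comm, ← nsmul_eq_mul]
    calc I.card • a i' ^ q = ∑ _i ∈ I, a i' ^ q := by rw [Finset.sum_const]
      _ ≤ ∑ i ∈ I, a i ^ q := Finset.sum_le_sum fun i hi =>
        ENNReal.rpow_le_rpow (hmax i hi i' hi') hq0.le
      _ ≤ A := ENNReal.sum_le_tsum _
  calc ∑' i : ((I : Set ι)ᶜ : Set ι), a i
      ≤ ∑' i : ((I : Set ι)ᶜ : Set ι), a i ^ q * (A / I.card) ^ s := by
        refine ENNReal.tsum_le_tsum fun i => ?_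
        -- Since `q + q * s = 1`; the first factor is summable and the second is bounded uniformly
        -- by `hle`.
        have h1 : a i = a i ^ q * (a i ^ q) ^ s := by
          rw [← ENNReal.rpow_mul, ← ENNReal.rpow_add_of_nonneg _ _ hq0.le (by positivity)]
          have : q + q * s = 1 := by rw [hq]; field_simp
          rw [this, ENNReal.rpow_one]
        nth_rewrite 1 [h1]
        exact mul_le_mul_right (ENNReal.rpow_le_rpow
          (hle i fun h => i.2 (Finset.mem_coe.2 h)) hs.le) _
    _ = (∑' i : ((I : Set ι)ᶜ : Set ι), a i ^ q) * (A / I.card) ^ s := ENNReal.tsum_mul_right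
    _ ≤ A * (A / I.card) ^ s :=
        mul_le_mul_left (ENNReal.tsum_comp_le_tsum_of_injective Subtype.val_injective _) _

lemma HasCompactSupport.exists_abs_bound {f : ℝ → ℝ} (h : HasCompactSupport f) :
    ∃ R : ℝ, 0 ≤ R ∧ ∀ x, R < |x| → f x = 0 := by
  obtain ⟨R, hR⟩ := h.isCompact.isBounded.subset_closedBall (0 : ℝ)
  refine ⟨max R 0, le_max_right _ _, fun x hx => ?_⟩
  by_contra hne
  have := hR (subset_tsupport f hne)
  rw [mem_closedBall_zero_iff, Real.norm_eq_abs] at this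
  exact absurd (lt_of_le_of_lt (le_max_left _ _) hx) this.not_gt

lemma exists_abs_bound_of_lt {f : ℕ → ℝ → ℝ} {n : ℕ} (h : ∀ k < n, HasCompactSupport (f k)) :
    ∃ R : ℝ, 0 ≤ R ∧ ∀ k < n, ∀ x, R < |x| → f k x = 0 := by
  induction n with
  | zero => exact ⟨0, le_rfl, fun k hk => absurd hk (Nat.not_lt_zero k)⟩
  | succ n ih =>
    obtain ⟨R₁, h1, h1'⟩ := ih fun k hk => h k (hk.trans n.lt_succ_self)
    obtain ⟨R₂, -, h2'⟩ := (h n n.lt_succ_self).exists_abs_bound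
    refine ⟨max R₁ R₂, h1.trans (le_max_left _ _), fun k hk x hx => ?_⟩
    rcases Nat.lt_succ_iff_lt_or_eq.1 hk with hk | rfl
    · exact h1' k hk x ((le_max_left _ _).trans_lt hx)
    · exact h2' x ((le_max_right _ _).trans_lt hx)

/-- The functions of scale `j` live on intervals of length proportional to `2^{-j}`. -/
lemma EdgeGenerator.IsCompactlySupportedL2.exists_support_radius {G : EdgeGenerator}
    (hG : G.IsCompactlySupportedL2) :
    ∃ R : ℝ, 0 < R ∧ ∀ j k : ℕ, k < 2 ^ j → ∃ t₀ : unitInterval, ∀ x : ℝ,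
      R / 2 ^ j < |x - t₀| → G.atScale j k x = 0 := by
  obtain ⟨R₁, h1, h1'⟩ := hG.interior_support.exists_abs_bound
  obtain ⟨R₂, h2, h2'⟩ := exists_abs_bound_of_lt hG.left_support
  obtain ⟨R₃, h3, h3'⟩ := exists_abs_bound_of_lt hG.right_support
  -- The sum dominates the radii of all three kinds of generators; the 1 keeps it positive. The
  -- centre is 0, 1 or `k / 2^j`.
  refine ⟨R₁ + R₂ + R₃ + 1, by positivity, fun j k hk => ?_⟩
  have h2j : (0 : ℝ) < 2 ^ j := by positivity
  have key : ∀ {R t x : ℝ}, R ≤ R₁ + R₂ + R₃ + 1 →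
      (R₁ + R₂ + R₃ + 1) / 2 ^ j < |x - t| → R < |2 ^ j * (x - t)| := by
    intro R t x hR hx
    rw [abs_mul, abs_of_pos h2j, mul_comm]
    exact lt_of_le_of_lt hR ((div_lt_iff₀ h2j).1 hx)
  by_cases hl : k < G.nLeft
  · refine ⟨0, fun x hx => ?_⟩
    rw [EdgeGenerator.atScale, if_pos hl, h2' k hl, mul_zero]
    have := key (R := R₂) (by linarith) hx
    simpa using this
  · by_cases hr : 2 ^ j ≤ k + G.nRight
    · refine ⟨1, fun x hx => ?_⟩
      rw [EdgeGenerator.atScale, if_neg hl, if_pos hr, h3' _ (by omega), mul_zero]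
      have := key (R := R₃) (by linarith) hx
      rwa [← abs_neg, ← mul_neg, neg_sub] at this
    · refine ⟨⟨k / 2 ^ j, by positivity, ?_⟩, fun x hx => ?_⟩
      · rw [div_le_one h2j]; exact_mod_cast hk.le
      · rw [EdgeGenerator.atScale, if_neg hl, if_neg hr, h1', mul_zero]
        have := key (R := R₁) (by linarith) hx
        rwa [mul_sub, mul_div_cancel₀ _ h2j.ne'] at this

lemma unitInterval.volume_real_abs_sub_le (t₀ : unitInterval) {ρ : ℝ} (hρ : 0 ≤ ρ) :
    (volume : Measure unitInterval).real {t | |(t : ℝ) - t₀| ≤ ρ} ≤ 2 * ρ := by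
  have h : (volume : Measure unitInterval) {t | |(t : ℝ) - t₀| ≤ ρ} ≤
      ENNReal.ofReal (2 * ρ) := by
    rw [unitInterval.volume_apply]
    refine (measure_mono (t := Metric.closedBall (t₀ : ℝ) ρ) ?_).trans_eq (Real.volume_closedBall _ _)
    rintro _ ⟨t, ht, rfl⟩
    simpa [Real.dist_eq] using ht
  exact ENNReal.toReal_le_of_le_ofReal (by positivity) h

lemma L2I.integral_sq (f : L2I) : ∫ t, f t ^ 2 = ‖f‖ ^ 2 := by
  rw [← real_inner_self_eq_norm_sq, L2.inner_def]
  simp [pow_two]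

lemma L2I.integrable_sq (f : L2I) : Integrable fun t => f t ^ 2 :=
  (Lp.memLp f).integrable_sq

lemma L2I.integrable (f : L2I) : Integrable f :=
  (Lp.memLp f).integrable one_le_two

/-- Cauchy–Schwarz on a set of measure at most `2ρ`, obtained from `|f| ≤ (l/2) f² + 1/(2l)`; with
`l = √(2ρ)` each term contributes at most `l / 2`. -/
lemma L2I.integral_indicator_abs_le (f : L2I) (hf : ‖f‖ = 1) (t₀ : unitInterval) {ρ : ℝ}
    (hρ : 0 < ρ) :
    ∫ t, |({t : unitInterval | |(t : ℝ) - t₀| ≤ ρ}.indicator f) t| ≤ Real.sqrt (2 * ρ) := by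
  set A := {t : unitInterval | |(t : ℝ) - t₀| ≤ ρ} with hA
  have hAm : MeasurableSet A :=
    measurableSet_le (by fun_prop) measurable_const
  set l := Real.sqrt (2 * ρ) with hl
  have hl0 : 0 < l := Real.sqrt_pos.2 (by positivity)
  have hl2 : l ^ 2 = 2 * ρ := Real.sq_sqrt (by positivity)
  have h1 : ∀ t, |(A.indicator f) t| ≤ l / 2 * f t ^ 2 + A.indicator (fun _ => 1 / (2 * l)) t := by
    intro t
    by_cases ht : t ∈ A
    · simp only [Set.indicator_of_mem ht]
      have h := sq_nonneg (l * |f t| - 1)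
      rw [sub_sq, mul_pow, sq_abs] at h
      rw [← sub_nonneg]
      have : l / 2 * f t ^ 2 + 1 / (2 * l) - |f t| =
        (l ^ 2 * f t ^ 2 - 2 * (l * |f t|) * 1 + 1 ^ 2) / (2 * l) := by
        field_simp; ring
      rw [this]
      exact div_nonneg h (by positivity)
    · simp only [Set.indicator_of_notMem ht, abs_zero, add_zero]
      positivity
  have i1 : Integrable fun t => l / 2 * f t ^ 2 := (L2I.integrable_sq f).const_mul _
  have i2 : Integrable (A.indicator fun _ : unitInterval => 1 / (2 * l)) :=
    (integrable_const _).indicator hAm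
  refine (integral_mono ((L2I.integrable f).indicator hAm).abs (i1.add i2) h1).trans ?_
  simp only [Pi.add_apply]
  rw [integral_add i1 i2, integral_const_mul, L2I.integral_sq, hf, integral_indicator_const _ hAm]
  have h3 := unitInterval.volume_real_abs_sub_le t₀ hρ.le
  rw [← hA, ← hl2] at h3
  have h4 : volume.real A * (1 / (2 * l)) ≤ l ^ 2 * (1 / (2 * l)) :=
    mul_le_mul_of_nonneg_right h3 (by positivity)
  have h5 : l ^ 2 * (1 / (2 * l)) = l / 2 := by field_simp
  simp only [smul_eq_mul]
  linarith

/-- A polynomial is orthogonal to a tensor square with vanishing moments. -/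
lemma integral_mvPolynomial_mul_eq_zero {G : unitInterval → ℝ} (hG : Integrable G) {M : ℕ}
    (hvan : ∀ l < M, ∫ t : unitInterval, (t : ℝ) ^ l * G t = 0) (p : MvPolynomial (Fin 2) ℝ)
    (hp : p.totalDegree < M) :
    ∫ z : unitInterval × unitInterval,
      MvPolynomial.eval ![(z.1 : ℝ), (z.2 : ℝ)] p * (G z.1 * G z.2) = 0 := by
  have hi : ∀ l : ℕ, Integrable fun t : unitInterval => (t : ℝ) ^ l * G t := fun l => by
    refine hG.bdd_mul (c := 1) (by fun_prop) (Filter.Eventually.of_forall fun t => ?_)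
    rw [norm_pow]
    exact pow_le_one₀ (norm_nonneg _) (abs_le.2 ⟨by linarith [t.2.1], t.2.2⟩)
  have he : ∀ z : unitInterval × unitInterval,
      MvPolynomial.eval ![(z.1 : ℝ), (z.2 : ℝ)] p * (G z.1 * G z.2) =
      ∑ d ∈ p.support, p.coeff d * (((z.1 : ℝ) ^ d 0 * G z.1) * ((z.2 : ℝ) ^ d 1 * G z.2)) := by
    intro z
    rw [MvPolynomial.eval_eq', Finset.sum_mul]
    refine Finset.sum_congr rfl fun d _ => ?_
    simp only [Fin.prod_univ_two, Matrix.cons_val_zero, Matrix.cons_val_one]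
    ring
  simp only [he]
  rw [integral_finsetSum _ fun d _ => ((hi (d 0)).mul_prod (hi (d 1))).const_mul _]
  refine Finset.sum_eq_zero fun d hd => ?_
  -- One exponent suffices: each monomial splits into a product of two integrals, and the first
  -- vanishes.
  have hd0 : d 0 < M := by
    have h := MvPolynomial.le_totalDegree hd
    rw [Finsupp.sum_fintype _ _ (fun _ => rfl), Fin.sum_univ_two] at h
    omega
  rw [integral_const_mul, Measure.volume_eq_prod,
    integral_prod_mul (fun t : unitInterval => (t : ℝ) ^ d 0 * G t)
      (fun t : unitInterval => (t : ℝ) ^ d 1 * G t), hvan _ hd0, zero_mul, mul_zero]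

end Rates

/-! ### Decay of the second moments and the two rates -/

namespace RankingModel

variable {Ω : Type*} [MeasurableSpace Ω] {P : Measure Ω} [IsProbabilityMeasure P]
  (D : RankingModel P)

omit [IsProbabilityMeasure P] in
lemma integral_abs_mul_le (t s : unitInterval) :
    ∫ ω, |D.X ω t * D.X ω s| ∂P ≤ (D.autocorr t t + D.autocorr s s) / 2 := by
  have hi : ∀ t s, Integrable (fun ω => D.X ω t * D.X ω s) P := fun t s =>
    (D.second_order t).integrable_mul (D.second_order s)
  rw [autocorr, autocorr, ← integral_add (hi t t) (hi s s), ← integral_div]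
  refine integral_mono (hi t s).abs (((hi t t).add (hi s s)).div_const 2) fun ω => ?_
  have h := sq_nonneg (|D.X ω t| - |D.X ω s|)
  rw [sub_sq, sq_abs, sq_abs] at h
  simp only [abs_mul]
  linarith

/-- By Fubini the moment is the double integral of `C_X(t,s) g(t) g(s)`. Vanishing moments allow the
polynomial to be subtracted from `C_X`; what remains is at most `|c| (2ρ)^a` on the support,
multiplied by `‖g‖₁² ≤ 2ρ`. -/
lemma coeffMoment_le_of_approx {g : ℝ → ℝ} {f : L2I}
    (hfg : (f : unitInterval → ℝ) =ᵐ[volume] fun t : unitInterval => g t) (hf : ‖f‖ = 1)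
    {t₀ : unitInterval} {ρ c a : ℝ} (hρ : 0 < ρ) (ha : 0 ≤ a)
    (hsupp : ∀ x : ℝ, ρ < |x - t₀| → g x = 0) {M : ℕ}
    (hvan : ∀ l < M, ∫ t : unitInterval, (t : ℝ) ^ l * g t = 0)
    {p : MvPolynomial (Fin 2) ℝ} (hp : p.totalDegree < M)
    (happ : ∀ t s : unitInterval, |(t : ℝ) - t₀| ≤ ρ → |(s : ℝ) - t₀| ≤ ρ →
      |D.autocorr t s - MvPolynomial.eval ![(t : ℝ), (s : ℝ)] p| ≤
        c * (|(t : ℝ) - t₀| + |(s : ℝ) - t₀|) ^ a) :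
    D.coeffMoment g ≤ ENNReal.ofReal (|c| * (2 * ρ) ^ a * (2 * ρ)) := by
  set A := {t : unitInterval | |(t : ℝ) - t₀| ≤ ρ} with hA
  have hAm : MeasurableSet A := measurableSet_le (by fun_prop) measurable_const
  set G : unitInterval → ℝ := A.indicator f with hG
  have hGm : Measurable G := (Lp.stronglyMeasurable f).measurable.indicator hAm
  have hGi : Integrable G := (L2I.integrable f).indicator hAm
  have hG0 : ∀ t, t ∉ A → G t = 0 := fun t ht => Set.indicator_of_notMem ht _
  have hGg : G =ᵐ[volume] fun t : unitInterval => g t := by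
    filter_upwards [hfg] with t ht
    by_cases htA : t ∈ A
    · rw [hG, Set.indicator_of_mem htA, ht]
    · rw [hG0 t htA, hsupp t (not_le.1 htA)]
  have hG1 : ∫ t, |G t| ≤ Real.sqrt (2 * ρ) := L2I.integral_indicator_abs_le f hf t₀ hρ
  have hGvan : ∀ l < M, ∫ t : unitInterval, (t : ℝ) ^ l * G t = 0 := fun l hl => by
    rw [← hvan l hl]
    refine integral_congr_ae ?_
    filter_upwards [hGg] with t ht
    rw [ht]
  have hcoeff : ∀ ω, D.coeff g ω = ∫ t, D.X ω t * G t := fun ω => by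
    refine integral_congr_ae ?_
    filter_upwards [hGg] with t ht
    rw [ht]
  set q : unitInterval × unitInterval → ℝ := fun z =>
    MvPolynomial.eval ![(z.1 : ℝ), (z.2 : ℝ)] p with hq
  have hqc : Continuous q := by
    have : Continuous fun z : unitInterval × unitInterval => ![(z.1 : ℝ), (z.2 : ℝ)] := by
      refine continuous_pi fun i => ?_
      fin_cases i
      · exact continuous_subtype_val.comp continuous_fst
      · exact continuous_subtype_val.comp continuous_snd
    exact (MvPolynomial.continuous_eval p).comp this
  obtain ⟨Q, hQ⟩ := isCompact_univ.exists_bound_of_continuousOn hqc.continuousOn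
  have happ' : ∀ t ∈ A, ∀ s ∈ A, |D.autocorr t s - q (t, s)| ≤ |c| * (2 * ρ) ^ a := by
    intro t ht s hs
    refine (happ t s ht hs).trans ?_
    have h2 : |(t : ℝ) - t₀| + |(s : ℝ) - t₀| ≤ 2 * ρ := by
      have h3 : |(t : ℝ) - t₀| ≤ ρ := ht
      have h4 : |(s : ℝ) - t₀| ≤ ρ := hs
      linarith
    exact mul_le_mul (le_abs_self c) (Real.rpow_le_rpow (by positivity) h2 ha) (by positivity)
      (abs_nonneg c)
  -- The local approximation bounds `C_X(t,t)` on the support, hence `E|X(t)X(s)|`. This gives the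
  -- integrability required by Fubini without a global bound on `C_X`.
  set B := Q + |c| * (2 * ρ) ^ a with hB
  have hdiag : ∀ t ∈ A, D.autocorr t t ≤ B := by
    intro t ht
    have h1 := (le_abs_self _).trans (happ' t ht t ht)
    have h2 := (le_abs_self _).trans (hQ (t, t) (Set.mem_univ _))
    linarith
  set H : Ω → unitInterval × unitInterval → ℝ := fun ω z =>
    (D.X ω z.1 * G z.1) * (D.X ω z.2 * G z.2) with hH
  have hHm : Measurable (Function.uncurry H) := by
    have h1 : Measurable fun y : Ω × (unitInterval × unitInterval) => D.X y.1 y.2.1 :=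
      D.measurable_X.comp (measurable_fst.prodMk (measurable_fst.comp measurable_snd))
    have h2 : Measurable fun y : Ω × (unitInterval × unitInterval) => D.X y.1 y.2.2 :=
      D.measurable_X.comp (measurable_fst.prodMk (measurable_snd.comp measurable_snd))
    exact (h1.mul (hGm.comp (measurable_fst.comp measurable_snd))).mul
      (h2.mul (hGm.comp (measurable_snd.comp measurable_snd)))
  have hHz : ∀ z, (fun ω => H ω z) = fun ω => (D.X ω z.1 * D.X ω z.2) * (G z.1 * G z.2) := by
    intro z; ext ω; simp only [hH]; ring
  have hXi : ∀ t s, Integrable (fun ω => D.X ω t * D.X ω s) P := fun t s =>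
    (D.second_order t).integrable_mul (D.second_order s)
  have hGG : Integrable (fun z : unitInterval × unitInterval => G z.1 * G z.2) :=
    hGi.mul_prod hGi
  have hGGa : Integrable (fun z : unitInterval × unitInterval => |G z.1| * |G z.2|) :=
    hGi.abs.mul_prod hGi.abs
  have hHi : Integrable (Function.uncurry H) (P.prod volume) := by
    rw [integrable_prod_iff' hHm.aestronglyMeasurable]
    refine ⟨Filter.Eventually.of_forall fun z => ?_, ?_⟩
    · simp only [Function.uncurry_apply_pair]
      rw [hHz]
      exact (hXi _ _).mul_const _
    · refine (hGGa.const_mul B).mono'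
        hHm.norm.stronglyMeasurable.integral_prod_left'.aestronglyMeasurable
        (Filter.Eventually.of_forall fun z => ?_)
      rw [Real.norm_of_nonneg (integral_nonneg fun ω => norm_nonneg _)]
      simp only [Function.uncurry_apply_pair]
      have h1 : ∀ ω, ‖H ω z‖ = |D.X ω z.1 * D.X ω z.2| * (|G z.1| * |G z.2|) := by
        intro ω
        rw [congrFun (hHz z) ω, norm_mul, Real.norm_eq_abs, Real.norm_eq_abs, abs_mul (G z.1)]
      simp only [h1]
      rw [integral_mul_const]
      by_cases hz : z.1 ∈ A ∧ z.2 ∈ A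
      · refine mul_le_mul_of_nonneg_right ?_ (by positivity)
        have := D.integral_abs_mul_le z.1 z.2
        linarith [hdiag _ hz.1, hdiag _ hz.2]
      · have : |G z.1| * |G z.2| = 0 := by
          rcases not_and_or.1 hz with h | h <;> simp [hG0 _ h]
        rw [this, mul_zero, mul_zero]
  have hsq : ∀ ω, D.coeff g ω ^ 2 = ∫ z, H ω z := by
    intro ω
    rw [hcoeff, pow_two, Measure.volume_eq_prod,
      integral_prod_mul (fun t => D.X ω t * G t) (fun t => D.X ω t * G t)]
  have hsqi : Integrable (fun ω => D.coeff g ω ^ 2) P := by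
    simp only [hsq]
    exact hHi.integral_prod_left
  have hmom : D.coeffMoment g = ENNReal.ofReal (∫ ω, D.coeff g ω ^ 2 ∂P) := by
    rw [ofReal_integral_eq_lintegral_ofReal hsqi
      (Filter.Eventually.of_forall fun ω => sq_nonneg _), coeffMoment]
    refine lintegral_congr fun ω => ?_
    rw [← sq_abs, ENNReal.ofReal_pow (abs_nonneg _), ← Real.norm_eq_abs, ofReal_norm]
  rw [hmom]
  refine ENNReal.ofReal_le_ofReal ?_
  have hC : ∀ z : unitInterval × unitInterval,
      ∫ ω, H ω z ∂P = D.autocorr z.1 z.2 * (G z.1 * G z.2) := by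
    intro z
    rw [hHz, integral_mul_const, autocorr]
  have hCi : Integrable fun z : unitInterval × unitInterval =>
      D.autocorr z.1 z.2 * (G z.1 * G z.2) := by
    simp only [← hC]
    exact hHi.integral_prod_right
  have hqi : Integrable fun z => q z * (G z.1 * G z.2) :=
    hGG.bdd_mul (c := Q) hqc.aestronglyMeasurable
      (Filter.Eventually.of_forall fun z => hQ z (Set.mem_univ _))
  calc ∫ ω, D.coeff g ω ^ 2 ∂P
      = ∫ ω, (∫ z, H ω z) ∂P := by simp only [hsq]
    _ = ∫ z : unitInterval × unitInterval, D.autocorr z.1 z.2 * (G z.1 * G z.2) := by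
        rw [integral_integral_swap hHi]; simp only [hC]
    _ = ∫ z : unitInterval × unitInterval, (D.autocorr z.1 z.2 * (G z.1 * G z.2) - q z * (G z.1 * G z.2)) := by
        rw [integral_sub hCi hqi, integral_mvPolynomial_mul_eq_zero hGi hGvan p hp, sub_zero]
    _ ≤ ∫ z : unitInterval × unitInterval, |c| * (2 * ρ) ^ a * (|G z.1| * |G z.2|) := by
        refine integral_mono (hCi.sub hqi) (hGGa.const_mul _) fun z => ?_
        refine (le_abs_self _).trans ?_
        rw [← sub_mul, abs_mul, abs_mul (G z.1)]
        by_cases hz : z.1 ∈ A ∧ z.2 ∈ A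
        · exact mul_le_mul_of_nonneg_right (happ' _ hz.1 _ hz.2) (by positivity)
        · have : |G z.1| * |G z.2| = 0 := by
            rcases not_and_or.1 hz with h | h <;> simp [hG0 _ h]
          rw [this, mul_zero, mul_zero]
    _ = |c| * (2 * ρ) ^ a * ((∫ t, |G t|) * ∫ t, |G t|) := by
        rw [integral_const_mul, Measure.volume_eq_prod,
          integral_prod_mul (fun t => |G t|) (fun t => |G t|)]
    _ ≤ |c| * (2 * ρ) ^ a * (2 * ρ) := by
        refine mul_le_mul_of_nonneg_left ?_ (by positivity)
        rw [← pow_two, ← Real.sq_sqrt (by positivity : (0 : ℝ) ≤ 2 * ρ)]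
        exact pow_le_pow_left₀ (integral_nonneg fun t => abs_nonneg _) hG1 2

/-- Decay across scales of the second moments of the wavelet coefficients. -/
lemma exists_coeffMoment_wavelet_le {φ ψ : EdgeGenerator} {M J : ℕ}
    (h : IsIntervalWavelet φ ψ M J) {a : ℝ} (ha : 0 ≤ a) (haM : a < M)
    (hC : IsOfClassOnDiagonal D.autocorr a) :
    ∃ E : ℝ, 0 ≤ E ∧ ∃ j₁ : ℕ, J ≤ j₁ ∧ ∀ j, j₁ ≤ j → ∀ k < 2 ^ j,
      D.coeffMoment (ψ.atScale j k) ≤ ENNReal.ofReal (E * ((2 : ℝ) ^ j) ^ (-a) / 2 ^ j) := by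
  obtain ⟨c, δ, hδ, hC⟩ := hC
  obtain ⟨R, hR, hsupp⟩ := h.wavelet_supp.exists_support_radius
  -- From level `j₂` on, supports of radius `R / 2^j` fit into the neighbourhoods of size `δ`.
  obtain ⟨j₂, hj₂⟩ := pow_unbounded_of_one_lt (R / δ) (one_lt_two (α := ℝ))
  refine ⟨|c| * (2 * R) ^ a * (2 * R), by positivity, max J j₂, le_max_left _ _, ?_⟩
  intro j hj k hk
  obtain ⟨b, hb⟩ := h.basis j ((le_max_left _ _).trans hj)
  -- `ψ_{j,k}` belongs to the basis with coarsest level `j`, at offset 0; this is the source of its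
  -- unit norm.
  have hbk := hb (Sum.inr ⟨0, ⟨k, hk⟩⟩)
  obtain ⟨t₀, ht₀⟩ := hsupp j k hk
  obtain ⟨p, hp, happ⟩ := hC t₀
  have h2j : (0 : ℝ) < 2 ^ j := by positivity
  have hρδ : R / 2 ^ j ≤ δ := by
    rw [div_le_iff₀ h2j, mul_comm, ← div_le_iff₀ hδ]
    exact hj₂.le.trans (pow_le_pow_right₀ one_le_two ((le_max_right _ _).trans hj))
  have hpM : p.totalDegree < M := by
    refine lt_of_le_of_lt hp ?_
    rwa [Nat.floor_lt ha]
  have hmain := D.coeffMoment_le_of_approx (c := c) (a := a) hbk (b.orthonormal.1 _)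
    (div_pos hR h2j) ha ht₀ (h.vanishing j ((le_max_left _ _).trans hj) k hk) hpM
    (fun t s ht hs => happ t s (ht.trans hρδ) (hs.trans hρδ))
  refine hmain.trans_eq ?_
  congr 1
  rw [← mul_div_assoc, Real.div_rpow (by positivity) h2j.le, Real.rpow_neg h2j.le]
  field_simp

/-- The rate of linear approximation, in terms of the number `2 ^ j` of coefficients. -/
lemma exists_aucStar_sub_aucLinear_le (hη : ∃ K : ℝ≥0, LipschitzOnWith K D.η D.paths)
    {φ ψ : EdgeGenerator} {M J : ℕ} (h : IsIntervalWavelet φ ψ M J) {r : ℝ} (hr : 0 < r)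
    (hrM : 2 * r < M) (hC : IsOfClassOnDiagonal D.autocorr (2 * r)) :
    ∃ c : ℝ, ∀ j : ℕ, D.aucStar - D.aucLinear φ j ≤ c * ((2 : ℝ) ^ j) ^ (-r) := by
  obtain ⟨C, hC0, hopt⟩ := D.exists_aucStar_sub_optimalAUC_le hη
  obtain ⟨E, hE, j₁, hj₁, hdecay⟩ := D.exists_coeffMoment_wavelet_le h (by positivity) hrM hC
  set x : ℝ := (2 : ℝ) ^ (-(2 * r)) with hx
  have hx0 : 0 < x := by positivity
  have hx1 : x < 1 := Real.rpow_lt_one_of_one_lt_of_neg one_lt_two (by linarith)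
  have hpow : ∀ j : ℕ, ((2 : ℝ) ^ j) ^ (-(2 * r)) = x ^ j := fun j => by
    rw [← Real.rpow_natCast_mul zero_le_two, mul_comm, Real.rpow_mul_natCast zero_le_two]
  have hlarge : ∀ j, j₁ ≤ j → D.aucStar - D.aucLinear φ j ≤
      C * Real.sqrt (E * (1 - x)⁻¹) * ((2 : ℝ) ^ j) ^ (-r) := by
    intro j hj
    rw [mul_assoc]
    refine hopt (h.basis j (hj₁.trans hj)) (e := Sum.inl) Sum.inl_injective (by positivity) ?_
    have h1x : 0 ≤ (1 - x)⁻¹ := inv_nonneg.2 (by linarith)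
    have hB : (Real.sqrt (E * (1 - x)⁻¹) * ((2 : ℝ) ^ j) ^ (-r)) ^ 2 =
        ∑' m : ℕ, E * x ^ j * x ^ m := by
      rw [tsum_mul_left, tsum_geometric_of_lt_one hx0.le hx1, mul_pow,
        Real.sq_sqrt (mul_nonneg hE h1x), ← hpow, ← Real.rpow_mul_natCast (by positivity)]
      have : -r * ((2 : ℕ) : ℝ) = -(2 * r) := by push_cast; ring
      rw [this]; ring
    rw [hB, ENNReal.ofReal_tsum_of_nonneg (fun m => by positivity)
      ((summable_geometric_of_lt_one hx0.le hx1).mul_left _),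
      Set.isCompl_range_inl_range_inr.compl_eq,
      tsum_range (fun i => D.coeffMoment (waveletFamily φ ψ j i)) Sum.inr_injective,
      ENNReal.tsum_sigma']
    -- Level `j + m` has `2^(j+m)` wavelets, which cancels the factor `1 / 2^(j+m)` in the decay and
    -- leaves `E * x^(j+m)`.
    refine ENNReal.tsum_le_tsum fun m => ?_
    rw [tsum_fintype]
    refine (Finset.sum_le_sum fun (k : Fin (2 ^ (j + m))) _ =>
      hdecay (j + m) (hj.trans (Nat.le_add_right _ _)) k k.2).trans_eq ?_
    rw [Finset.sum_const, Finset.card_univ, Fintype.card_fin, nsmul_eq_mul, hpow,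
      ← ENNReal.ofReal_natCast, ← ENNReal.ofReal_mul (Nat.cast_nonneg _)]
    congr 1
    push_cast
    rw [pow_add x]
    field_simp
  -- The finitely many levels below `j₁`, where the decay estimate is not available, are absorbed
  -- into the constant.
  refine ⟨max (C * Real.sqrt (E * (1 - x)⁻¹))
    (∑ j ∈ Finset.range j₁, |D.aucStar - D.aucLinear φ j| * ((2 : ℝ) ^ j) ^ r), fun j => ?_⟩
  have h2j : (0 : ℝ) < 2 ^ j := by positivity
  rcases le_or_gt j₁ j with hj | hj
  · exact (hlarge j hj).trans (mul_le_mul_of_nonneg_right (le_max_left _ _) (by positivity))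
  · have h1 := Finset.single_le_sum
      (f := fun j => |D.aucStar - D.aucLinear φ j| * ((2 : ℝ) ^ j) ^ r)
      (fun i _ => by positivity) (Finset.mem_range.2 hj)
    refine le_trans ?_ (mul_le_mul_of_nonneg_right (h1.trans (le_max_right _ _)) (by positivity))
    rw [mul_assoc, ← Real.rpow_add h2j, add_neg_cancel, Real.rpow_zero, mul_one]
    exact le_abs_self _

/-- The rate of best `N`-term approximation. -/
lemma exists_aucStar_sub_aucNonlinear_le (hη : ∃ K : ℝ≥0, LipschitzOnWith K D.η D.paths)
    {φ ψ : EdgeGenerator} {M J : ℕ} (h : IsIntervalWavelet φ ψ M J) {j₀ : ℕ} (hj₀ : J ≤ j₀)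
    {r p : ℝ} (hr : 0 < r) (hp : p = 2 / (1 + 2 * r))
    (hsum : ∑' i : WaveletIndex j₀, D.coeffMoment (waveletFamily φ ψ j₀ i) ^ (p / 2) < ∞) :
    ∃ c : ℝ, ∀ N : ℕ, 1 ≤ N → ∀ I : Finset (WaveletIndex j₀), I.card = N →
      D.IsLargest φ ψ j₀ I →
      D.aucStar - D.aucNonlinear φ ψ j₀ I ≤ c * (N : ℝ) ^ (-r) := by
  obtain ⟨C, hC0, hopt⟩ := D.exists_aucStar_sub_optimalAUC_le hη
  set A := ∑' i : WaveletIndex j₀, D.coeffMoment (waveletFamily φ ψ j₀ i) ^ (p / 2) with hA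
  have hA0 : 0 ≤ A.toReal := ENNReal.toReal_nonneg
  refine ⟨C * Real.sqrt (A.toReal * A.toReal ^ (2 * r)), fun N hN I hI hlarge => ?_⟩
  have hN0 : (0 : ℝ) < N := by exact_mod_cast hN
  rw [mul_assoc]
  refine hopt (h.basis j₀ hj₀) (e := fun i : I => (i : WaveletIndex j₀))
    Subtype.val_injective (by positivity) ?_
  -- Here `p / 2 = 1 / (1 + 2r)`, so `s = 2r` and the tail is at most `A (A / N)^(2r)`; its square
  -- root has order `N^(-r)`.
  have hst := ENNReal.tsum_compl_le_of_largest
    (a := fun i => D.coeffMoment (waveletFamily φ ψ j₀ i)) (s := 2 * r) (q := p / 2)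
    (by positivity) (by rw [hp]; field_simp) I (hI ▸ hN) hlarge
  have hrange : Set.range (fun i : I => (i : WaveletIndex j₀)) = (I : Set (WaveletIndex j₀)) := by
    ext i; simp
  rw [hrange]
  refine hst.trans_eq ?_
  rw [← hA, hI, ← ENNReal.ofReal_toReal hsum.ne, ← ENNReal.ofReal_natCast,
    ← ENNReal.ofReal_div_of_pos hN0, ENNReal.ofReal_rpow_of_nonneg (by positivity) (by positivity),
    ← ENNReal.ofReal_mul hA0, mul_pow, Real.sq_sqrt (by positivity),
    ← Real.rpow_mul_natCast hN0.le, Real.div_rpow hA0 hN0.le]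
  have : -r * ((2 : ℕ) : ℝ) = -(2 * r) := by push_cast; ring
  rw [this, Real.rpow_neg hN0.le, ENNReal.toReal_ofReal hA0]
  congr 1
  field_simp

end RankingModel

theorem proposition1 {Ω : Type*} [MeasurableSpace Ω] (P : Measure Ω) [IsProbabilityMeasure P]
    (D : RankingModel P) (hη : ∃ K : ℝ≥0, LipschitzOnWith K D.η D.paths)
    (φ ψ : EdgeGenerator) (M J : ℕ) (hφψ : IsIntervalWavelet φ ψ M J) :
    (∀ r : ℝ, 0 < r → r < ((M : ℝ) - 1) / 2 →
      IsOfClassOnDiagonal D.autocorr (2 * r) →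
      ∃ c : ℝ, ∀ j : ℕ, D.aucStar - D.aucLinear φ j ≤ c * ((2 : ℝ) ^ j) ^ (-r)) ∧
    (∀ j₀ : ℕ, J ≤ j₀ → ∀ r p : ℝ, 0 < r → r < M → p = 2 / (1 + 2 * r) →
      ∑' i : WaveletIndex j₀, D.coeffMoment (waveletFamily φ ψ j₀ i) ^ (p / 2) < ∞ →
      ∃ c : ℝ, ∀ N : ℕ, 1 ≤ N → ∀ I : Finset (WaveletIndex j₀), I.card = N →
        D.IsLargest φ ψ j₀ I →
        D.aucStar - D.aucNonlinear φ ψ j₀ I ≤ c * (N : ℝ) ^ (-r)) := by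
  exact ⟨fun r hr hrM hC =>
      D.exists_aucStar_sub_aucLinear_le hη hφψ hr (by linarith) hC,
    fun j₀ hj₀ r p hr _ hp hsum =>
      D.exists_aucStar_sub_aucNonlinear_le hη hφψ hj₀ hr hp hsum⟩
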